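/- Let $\Theta\subset\mathbb R^q$ be open, bounded and convex with closure $\Theta^c$, and let $a:[0,\infty)\times\Theta^c\to\mathbb R$ be continuous, with $a(t,\cdot)\in C^1(\Theta)$ for every $t\ge 0$. For $\theta\in\Theta$ consider the model $X(t)=a(t,\theta)+\varepsilon(t)$, $t\ge 0$, where the noise $\varepsilon=\{\varepsilon(t),\,t\in\mathbb R\}$ satisfies the following. (N1) $\varepsilon$ is a mean-square continuous and almost surely continuous process on a probability space $(\Omega,\mathfrak F,P)$, with $E\varepsilon(t)=0$ for all $t$. (N2) (i) $\varepsilon$ is jointly strictly sub-Gaussian: with $B(t,s)=E\varepsilon(t)\varepsilon(s)$, for all $n$, $t_1,\dots,t_n\in\mathbb R$ and $\Delta_1,\dots,\Delta_n\in\mathbb R$, $E\exp\{\sum_i\Delta_i\varepsilon(t_i)\}\le\exp\{\tfrac12\sum_{i,j}B(t_i,t_j)\Delta_i\Delta_j\}$. (ii) For some $d_0>0$, for all $T>0$ and $\Delta\in L_2([0,T])$, $\int_0^T\!\int_0^T B(t,s)\Delta(t)\Delta(s)\,ds\,dt\le d_0\int_0^T\Delta^2(t)\,dt$. A least squares estimator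 $\theta_T$ is any random vector with values in $\Theta^c$ that (almost surely) minimizes $Q_T(\tau)=\int_0^T(X(t)-a(t,\tau))^2dt$ over $\tau\in\Theta^c$. Let $d_T(\theta)=\mathrm{diag}(d_{iT}(\theta))_{i=1}^q$, $d_{iT}^2(\theta)=\int_0^T(\partial a(t,\theta)/\partial\theta_i)^2dt$, $U_T(\theta)=d_T(\theta)(\Theta^c-\theta)$, $\Gamma_{T,\theta,R}=U_T(\theta)\cap\{u: R\le\|u\|\le R+1\}$, $\Delta(t,u)=a(t,\theta+d_T^{-1}(\theta)u)-a(t,\theta)$ and $\Phi_T(u,v)=\int_0^T(\Delta(t,u)-\Delta(t,v))^2dt$. Let $G$ be the family of functions $g=g_T(R)$, $T,R>0$, such that for each $T$, $g_T(R)\uparrow\infty$ as $R\to\infty$, and for each $r>0$, $R^r e^{-g_T(R)}\to0$ as $R,T\to\infty$. Let $K\subset\Theta$ be a set of possible true parameter values (for instance a single point). Assume that there are $g\in G$, constants $\delta\in(0,\frac12)$, $\varkappa>0$, $\rho\in(0,1]$, $T_0,R_0\ge0$ and polynomials $\gamma_1,\gamma_2$ (none of them depending on $\theta$) such that for all $\theta\in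 K$, $T>T_0$, $R>R_0$: $0<d_{iT}^2(\theta)<\infty$ for $i=1,\dots,q$, and (R1) (i) $\Phi_T(u,v)\le\gamma_1(R)\|u-v\|^{2\rho}$ for all $u,v\in\Gamma_{T,\theta,R}$ with $\|u-v\|\le\varkappa$; (ii) $\Phi_T(u,0)\le\gamma_2(R)$ for all $u\in\Gamma_{T,\theta,R}$; (R2) $\Phi_T(u,0)\ge 2d_0\delta^{-2}g_T(R)$ for all $u\in\Gamma_{T,\theta,R}$. Then there are $T_1\ge T_0$ and $R_1\ge R_0$ such that for every $\beta>0$ there is a constant $b_0>0$ with $b_0\ge\frac{\rho}{\rho+q}-\beta$ for which the following two assertions hold. (a) For every $\theta\in K$ there is $B_0>0$ such that for all $T>T_0$, $R>R_0$ and every least squares estimator $\theta_T$, $$P\{\|d_T(\theta)(\theta_T-\theta)\|\ge R\}\le B_0\exp\{-b_0g_T(R)\}.$$ (b) There is $B_0>0$, not depending on $\theta$, such that the same inequality holds for all $\theta\in K$, $T>T_1$, $R>R_1$ and every least squares estimator $\theta_T$. -/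

import Mathlib

open MeasureTheory Filter Topology

noncomputable section

namespace RegressionLD

/-- The parameter space `ℝ^q` with its Euclidean norm. -/
abbrev Param (q : ℕ) : Type := EuclideanSpace ℝ (Fin q)

/-! ### The noise -/

section Noise

variable {Ω : Type*} [MeasurableSpace Ω]

/-- A mean-square continuous and almost surely continuous, centred real stochastic process. -/
structure IsContinuousNoise (P : Measure Ω) (ε : ℝ → Ω → ℝ) : Prop where
  measurable : ∀ t, Measurable (ε t)
  memLp_two : ∀ t, MemLp (ε t) 2 P
  meanSquare_continuous :
    ∀ t, Tendsto (fun s => ∫ ω, (ε s ω - ε t ω) ^ 2 ∂P) (𝓝 t) (𝓝 0)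
  ae_continuous : ∀ᵐ ω ∂P, Continuous fun t => ε t ω
  mean_zero : ∀ t, ∫ ω, ε t ω ∂P = 0

/-- A strictly sub-Gaussian random vector: `E exp ⟨ξ, Δ⟩ ≤ exp (⟨B Δ, Δ⟩ / 2)` for every `Δ`, where
`B i j = E ξ_i ξ_j`; in particular the left-hand side is finite. -/
def IsStrictlySubGaussian (P : Measure Ω) {n : ℕ} (ξ : Fin n → Ω → ℝ) : Prop :=
  ∀ Δ : Fin n → ℝ,
    Integrable (fun ω => Real.exp (∑ i, ξ i ω * Δ i)) P ∧
      ∫ ω, Real.exp (∑ i, ξ i ω * Δ i) ∂P ≤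
        Real.exp (1 / 2 * ∑ i, ∑ j, (∫ ω, ξ i ω * ξ j ω ∂P) * Δ i * Δ j)

/-- A jointly strictly sub-Gaussian process: all its finite-dimensional vectors are strictly
sub-Gaussian. -/
def IsJointlyStrictlySubGaussian (P : Measure Ω) (ε : ℝ → Ω → ℝ) : Prop :=
  ∀ (n : ℕ) (t : Fin n → ℝ), IsStrictlySubGaussian P fun i => ε (t i)

/-- The covariance function `B(t, s) = E ε(t) ε(s)` of a centred process. -/
def covFun (P : Measure Ω) (ε : ℝ → Ω → ℝ) (t s : ℝ) : ℝ :=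
  ∫ ω, ε t ω * ε s ω ∂P

/-- The quadratic form of the covariance operator on `L₂[0, T]` is at most `d₀ ‖Δ‖²`, for every
`T > 0`. -/
def CovarianceBound (P : Measure Ω) (ε : ℝ → Ω → ℝ) (d₀ : ℝ) : Prop :=
  ∀ T : ℝ, 0 < T → ∀ Δ : ℝ → ℝ, MemLp Δ 2 (volume.restrict (Set.Icc 0 T)) →
    ∫ t in 0..T, ∫ s in 0..T, covFun P ε t s * Δ t * Δ s ≤ d₀ * ∫ t in 0..T, Δ t ^ 2

end Noise

/-! ### The regression function and the norming matrix -/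

section Regression

variable {q : ℕ}

/-- The partial derivative of `a(t, ·)` in the `i`-th parameter, at `θ`. -/
def partialDeriv (a : ℝ → Param q → ℝ) (i : Fin q) (t : ℝ) (θ : Param q) : ℝ :=
  fderiv ℝ (a t) θ (EuclideanSpace.single i 1)

/-- The diagonal entries `d_{iT}(θ)` of the norming matrix `d_T(θ)`. -/
def dEntry (a : ℝ → Param q → ℝ) (T : ℝ) (θ : Param q) (i : Fin q) : ℝ :=
  Real.sqrt (∫ t in 0..T, partialDeriv a i t θ ^ 2)

/-- The diagonal matrix with entries `c` applied to the vector `x`. -/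
def diagMul (c : Fin q → ℝ) (x : Param q) : Param q :=
  WithLp.toLp 2 fun i => c i * x i

/-- `d_T(θ) x`. -/
def dMul (a : ℝ → Param q → ℝ) (T : ℝ) (θ x : Param q) : Param q :=
  diagMul (dEntry a T θ) x

/-- `d_T(θ)⁻¹ u`. -/
def dInvMul (a : ℝ → Param q → ℝ) (T : ℝ) (θ u : Param q) : Param q :=
  diagMul (fun i => (dEntry a T θ i)⁻¹) u

/-- `U_T(θ) = d_T(θ) (Θᶜ - θ)`, where `Θᶜ` is the closure of `Θ`. -/
def normedSet (a : ℝ → Param q → ℝ) (Θ : Set (Param q)) (T : ℝ) (θ : Param q) :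
    Set (Param q) :=
  (fun τ => dMul a T θ (τ - θ)) '' closure Θ

/-- `Γ_{T, θ, R} = U_T(θ) ∩ {u : R ≤ ‖u‖ ≤ R + 1}`. -/
def shell (a : ℝ → Param q → ℝ) (Θ : Set (Param q)) (T : ℝ) (θ : Param q) (R : ℝ) :
    Set (Param q) :=
  normedSet a Θ T θ ∩ {u | R ≤ ‖u‖ ∧ ‖u‖ ≤ R + 1}

/-- `Δ(t, u) = a(t, θ + d_T(θ)⁻¹ u) - a(t, θ)`. -/
def increment (a : ℝ → Param q → ℝ) (T : ℝ) (θ : Param q) (t : ℝ) (u : Param q) : ℝ :=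
  a t (θ + dInvMul a T θ u) - a t θ

/-- `Φ_T(u, v) = ∫₀ᵀ (Δ(t, u) - Δ(t, v))² dt`. -/
def Phi (a : ℝ → Param q → ℝ) (T : ℝ) (θ u v : Param q) : ℝ :=
  ∫ t in 0..T, (increment a T θ t u - increment a T θ t v) ^ 2

/-- Standing assumptions on the regression function: `a` is continuous on `[0, ∞) × Θᶜ`, and
`a(t, ·)` is continuously differentiable on `Θ` for every `t ≥ 0`. -/
structure IsRegressionFunction (Θ : Set (Param q)) (a : ℝ → Param q → ℝ) : Prop where
  continuousOn : ContinuousOn (fun p : ℝ × Param q => a p.1 p.2) (Set.Ici 0 ×ˢ closure Θ)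
  contDiffOn : ∀ t : ℝ, 0 ≤ t → ContDiffOn ℝ 1 (a t) Θ

/-- The norming matrix `d_T(θ)` is a well-defined invertible matrix: `0 < d_{iT}(θ)² < ∞`. -/
def NormingWellDefined (a : ℝ → Param q → ℝ) (T : ℝ) (θ : Param q) : Prop :=
  ∀ i, IntervalIntegrable (fun t => partialDeriv a i t θ ^ 2) volume 0 T ∧
    0 < ∫ t in 0..T, partialDeriv a i t θ ^ 2

/-- The class `G` of functions `g_T(R)`, `T, R > 0`. -/
structure IsClassG (g : ℝ → ℝ → ℝ) : Prop where
  monotoneOn : ∀ T : ℝ, 0 < T → MonotoneOn (g T) (Set.Ioi 0)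
  tendsto_atTop : ∀ T : ℝ, 0 < T → Tendsto (g T) atTop atTop
  tendsto_zero : ∀ r : ℝ, 0 < r →
    Tendsto (fun p : ℝ × ℝ => p.2 ^ r * Real.exp (-g p.1 p.2)) (atTop ×ˢ atTop) (𝓝 0)

/-- The Hölder-type condition on the shell `Γ_{T, θ, R}`. -/
def CondR1i (a : ℝ → Param q → ℝ) (Θ : Set (Param q)) (γ : Polynomial ℝ) (κ ρ : ℝ)
    (θ : Param q) (T R : ℝ) : Prop :=
  ∀ u ∈ shell a Θ T θ R, ∀ v ∈ shell a Θ T θ R, ‖u - v‖ ≤ κ →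
    Phi a T θ u v ≤ γ.eval R * ‖u - v‖ ^ (2 * ρ)

/-- The polynomial upper bound on the shell `Γ_{T, θ, R}`. -/
def CondR1ii (a : ℝ → Param q → ℝ) (Θ : Set (Param q)) (γ : Polynomial ℝ)
    (θ : Param q) (T R : ℝ) : Prop :=
  ∀ u ∈ shell a Θ T θ R, Phi a T θ u 0 ≤ γ.eval R

/-- The growth condition on the shell `Γ_{T, θ, R}`. -/
def CondR2 (a : ℝ → Param q → ℝ) (Θ : Set (Param q)) (g : ℝ → ℝ → ℝ) (d₀ δ : ℝ)
    (θ : Param q) (T R : ℝ) : Prop :=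
  ∀ u ∈ shell a Θ T θ R, 2 * d₀ * (δ ^ 2)⁻¹ * g T R ≤ Phi a T θ u 0

end Regression

/-! ### The least squares estimator -/

section Estimator

variable {q : ℕ} {Ω : Type*} [MeasurableSpace Ω]

/-- The observed process `X(t) = a(t, θ) + ε(t)`. -/
def observation (a : ℝ → Param q → ℝ) (ε : ℝ → Ω → ℝ) (θ : Param q) (t : ℝ) (ω : Ω) : ℝ :=
  a t θ + ε t ω

/-- The functional `Q_T(τ) = ∫₀ᵀ (X(t) - a(t, τ))² dt` at the path of `ω`. -/
def lsFunctional (a : ℝ → Param q → ℝ) (ε : ℝ → Ω → ℝ) (θ : Param q) (T : ℝ) (ω : Ω)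
    (τ : Param q) : ℝ :=
  ∫ t in 0..T, (observation a ε θ t ω - a t τ) ^ 2

/-- `θhat` is a least squares estimator by the observations on `[0, T]`, when the true parameter
is `θ`: a random vector in the closure of `Θ` at which, almost surely, `Q_T` attains its infimum
over the closure of `Θ`. -/
structure IsLSE (P : Measure Ω) (a : ℝ → Param q → ℝ) (ε : ℝ → Ω → ℝ) (Θ : Set (Param q))
    (θ : Param q) (T : ℝ) (θhat : Ω → Param q) : Prop where
  measurable : Measurable θhat
  mem_closure : ∀ᵐ ω ∂P, θhat ω ∈ closure Θ
  isMinOn : ∀ᵐ ω ∂P, IsMinOn (lsFunctional a ε θ T ω) (closure Θ) (θhat ω)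

/-- `P {‖d_T(θ) (θ_T - θ)‖ ≥ R} ≤ B₀ exp (- b₀ g_T(R))` for every least squares estimator
`θ_T`. -/
def LSEDeviationBound (P : Measure Ω) (a : ℝ → Param q → ℝ) (ε : ℝ → Ω → ℝ)
    (Θ : Set (Param q)) (g : ℝ → ℝ → ℝ) (B₀ b₀ : ℝ) (θ : Param q) (T R : ℝ) : Prop :=
  ∀ θhat : Ω → Param q, IsLSE P a ε Θ θ T θhat →
    P.real {ω | R ≤ ‖dMul a T θ (θhat ω - θ)‖} ≤ B₀ * Real.exp (-(b₀ * g T R))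

end Estimator

end RegressionLD

end

/-! Write `W u` for the squared `L₂` norm of `increment a T θ · u`. Comparing `Q_T` at the estimator
and at the true `θ` shows that the normed error `u` satisfies `W u ≤ 2 ∫ ε(t) Δ(t, u) dt`. If its
norm is at least `R`, this happens at some point of one of the shells with radii `R`, `R + 1`, `R +
2`, ..., so it suffices to bound the probability of the inequality on each shell and to sum.

Linear functionals of the noise are sub-Gaussian with variance proxy `d₀` times the squared norm:
pass to the limit in Riemann sums with Fatou's lemma, then apply Chernoff
(`measure_le_noiseIntegral_le`). Since `δ < 1/2`, (R2) gives `W u ≥ 8 d₀ g` on a shell. At a single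
point this would yield the rate `exp (-g)`. To treat all points of the shell, a polynomially fine
net is used, with multiscale chaining between net and shell (`measure_chaining_le`), driven by the
Hölder bound (R1)(i). The loss is a factor polynomial in `R` and a drop of the rate to `9/16`
(`measure_exists_integral_sq_le_noiseIntegral`).

For `q ≥ 1` one has `ρ / (ρ + q) ≤ 1/2 < 9/16`. The spare `exp (-g/16)` absorbs the polynomial and
leaves a summable `1 / x ^ 2` over the shell radii, so `b₀ = ρ / (ρ + q)` itself works, with no loss
of `β`. This proves (b). For (a), whenever the deviation has positive probability outside the range
of (b), `R` is bounded and (R1)(ii) with (R2) bounds `g`, so a large `B₀` makes the claim trivial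
(`exists_deviationBound_of_large`). -/

/-! ### Riemann sums of continuous functions -/

section RiemannSums

/-- The largest multiple of `w` not exceeding `t`. -/
noncomputable def gridFloor (w t : ℝ) : ℝ := w * ⌊t / w⌋

theorem gridFloor_le {w : ℝ} (hw : 0 < w) (t : ℝ) : gridFloor w t ≤ t := by
  have h := Int.floor_le (t / w)
  rw [le_div_iff₀ hw] at h
  unfold gridFloor
  linarith

theorem sub_lt_gridFloor {w : ℝ} (hw : 0 < w) (t : ℝ) : t - w < gridFloor w t := by
  have h := Int.lt_floor_add_one (t / w)
  rw [div_lt_iff₀ hw] at h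
  unfold gridFloor
  linarith

theorem gridFloor_nonneg {w t : ℝ} (hw : 0 < w) (ht : 0 ≤ t) : 0 ≤ gridFloor w t := by
  have : 0 ≤ ⌊t / w⌋ := Int.floor_nonneg.2 (by positivity)
  unfold gridFloor
  positivity

theorem measurable_comp_gridFloor (w : ℝ) (F : ℝ → ℝ) :
    Measurable fun t => F (gridFloor w t) := by
  have h : Measurable fun k : ℤ => F (w * k) := measurable_of_countable _
  exact h.comp (Int.measurable_floor.comp (measurable_id.div_const w))

theorem gridFloor_eq {w : ℝ} (hw : 0 < w) {i : ℕ} {t : ℝ}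
    (ht : t ∈ Set.Ico ((i : ℝ) * w) (((i + 1 : ℕ) : ℝ) * w)) : gridFloor w t = w * i := by
  have h : ⌊t / w⌋ = (i : ℤ) := by
    rw [Int.floor_eq_iff, le_div_iff₀ hw, div_lt_iff₀ hw]
    have := ht.2
    push_cast at this ⊢
    exact ⟨ht.1, this⟩
  simp [gridFloor, h]

/-- Turns a Riemann sum into the integral of a step function over a fixed interval, so that limits
of Riemann sums follow from dominated convergence. The floor jumps only at right endpoints of cells,
a null set. -/
theorem sum_mul_eq_integral_gridFloor {w : ℝ} (hw : 0 < w) (n : ℕ) (F : ℝ → ℝ) :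
    ∑ i : Fin n, F (w * (i : ℕ)) * w = ∫ t in 0..(n * w), F (gridFloor w t) := by
  have hle : ∀ i : ℕ, (i : ℝ) * w ≤ ((i + 1 : ℕ) : ℝ) * w := fun i => by
    push_cast; nlinarith
  have hae : ∀ i : ℕ, ∀ᵐ t, t ∈ Set.uIoc ((i : ℝ) * w) (((i + 1 : ℕ) : ℝ) * w) →
      F (gridFloor w t) = F (w * i) := fun i => by
    have : ∀ᵐ t : ℝ, t ≠ ((i + 1 : ℕ) : ℝ) * w := by
      simp [ae_iff]
    filter_upwards [this] with t ht hmem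
    rw [Set.uIoc_of_le (hle i)] at hmem
    rw [gridFloor_eq hw ⟨hmem.1.le, lt_of_le_of_ne hmem.2 ht⟩]
  have hsum := intervalIntegral.sum_integral_adjacent_intervals (μ := volume) (n := n)
    (a := fun i : ℕ => (i : ℝ) * w) (f := fun t => F (gridFloor w t)) (fun i _ => by
      refine (intervalIntegrable_const (c := F (w * i))).congr_ae ?_
      rw [EventuallyEq, ae_restrict_iff' measurableSet_uIoc]
      filter_upwards [hae i] with t ht hmem
      exact (ht hmem).symm)
  simp only [Nat.cast_zero, zero_mul] at hsum
  rw [← hsum, Finset.sum_range]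
  refine Finset.sum_congr rfl fun i _ => ?_
  rw [intervalIntegral.integral_congr_ae (hae i), intervalIntegral.integral_const]
  push_cast
  rw [smul_eq_mul]
  ring

variable {T : ℝ}

theorem grid_step_tendsto (T : ℝ) : Tendsto (fun n : ℕ => T / (n + 1 : ℝ)) atTop (𝓝 0) :=
  tendsto_const_nhds.div_atTop (tendsto_atTop_add_const_right _ _ tendsto_natCast_atTop_atTop)

theorem tendsto_gridFloor (hT : 0 < T) (t : ℝ) :
    Tendsto (fun n : ℕ => gridFloor (T / (n + 1 : ℝ)) t) atTop (𝓝 t) := by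
  have hw : ∀ n : ℕ, 0 < T / (n + 1 : ℝ) := fun n => by positivity
  refine tendsto_of_tendsto_of_tendsto_of_le_of_le (g := fun n : ℕ => t - T / (n + 1 : ℝ)) ?_
    tendsto_const_nhds (fun n => (sub_lt_gridFloor (hw n) t).le) (fun n => gridFloor_le (hw n) t)
  simpa using tendsto_const_nhds.sub (grid_step_tendsto T)

theorem gridFloor_mem_Icc {w t : ℝ} (hw : 0 < w) (ht : t ∈ Set.Icc 0 T) :
    gridFloor w t ∈ Set.Icc 0 T :=
  ⟨gridFloor_nonneg hw ht.1, (gridFloor_le hw t).trans ht.2⟩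

theorem tendsto_integral_gridFloor (hT : 0 < T) {F : ℝ → ℝ} (hF : Continuous F) :
    Tendsto (fun n : ℕ => ∫ t in 0..T, F (gridFloor (T / (n + 1 : ℝ)) t)) atTop
      (𝓝 (∫ t in 0..T, F t)) := by
  obtain ⟨C, hC⟩ := isCompact_Icc.exists_bound_of_continuousOn (s := Set.Icc 0 T) hF.continuousOn
  refine intervalIntegral.tendsto_integral_filter_of_dominated_convergence (fun _ => C)
    (Eventually.of_forall fun n => (measurable_comp_gridFloor _ F).aestronglyMeasurable)
    (Eventually.of_forall fun n => Eventually.of_forall fun t ht => ?_)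
    intervalIntegrable_const
    (Eventually.of_forall fun t _ => (hF.tendsto t).comp (tendsto_gridFloor hT t))
  rw [Set.uIoc_of_le hT.le] at ht
  exact hC _ (gridFloor_mem_Icc (by positivity) ⟨ht.1.le, ht.2⟩)

theorem tendsto_integral_integral_gridFloor (hT : 0 < T) {G : ℝ → ℝ → ℝ}
    (hG : Continuous fun p : ℝ × ℝ => G p.1 p.2) :
    Tendsto (fun n : ℕ => ∫ t in 0..T, ∫ s in 0..T,
        G (gridFloor (T / (n + 1 : ℝ)) t) (gridFloor (T / (n + 1 : ℝ)) s)) atTop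
      (𝓝 (∫ t in 0..T, ∫ s in 0..T, G t s)) := by
  obtain ⟨C, hC⟩ := (isCompact_Icc.prod isCompact_Icc).exists_bound_of_continuousOn
    (s := Set.Icc 0 T ×ˢ Set.Icc 0 T) hG.continuousOn
  have hmem : ∀ n : ℕ, ∀ t ∈ Set.uIoc 0 T, gridFloor (T / (n + 1 : ℝ)) t ∈ Set.Icc 0 T :=
    fun n t ht => by
      rw [Set.uIoc_of_le hT.le] at ht
      exact gridFloor_mem_Icc (by positivity) ⟨ht.1.le, ht.2⟩
  have hbd : ∀ n : ℕ, ∀ t ∈ Set.uIoc 0 T, ∀ s ∈ Set.uIoc 0 T,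
      ‖G (gridFloor (T / (n + 1 : ℝ)) t) (gridFloor (T / (n + 1 : ℝ)) s)‖ ≤ C :=
    fun n t ht s hs => hC (_, _) ⟨hmem n t ht, hmem n s hs⟩
  refine intervalIntegral.tendsto_integral_filter_of_dominated_convergence (fun _ => C * |T - 0|)
    (Eventually.of_forall fun n => (measurable_comp_gridFloor _
      (fun x => ∫ s in 0..T, G x (gridFloor (T / (n + 1 : ℝ)) s))).aestronglyMeasurable)
    (Eventually.of_forall fun n => Eventually.of_forall fun t ht =>
      intervalIntegral.norm_integral_le_of_norm_le_const (hbd n t ht))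
    intervalIntegrable_const
    (Eventually.of_forall fun t ht => ?_)
  refine intervalIntegral.tendsto_integral_filter_of_dominated_convergence (fun _ => C)
    (Eventually.of_forall fun n => (measurable_comp_gridFloor _ _).aestronglyMeasurable)
    (Eventually.of_forall fun n => Eventually.of_forall fun s hs => hbd n t ht s hs)
    intervalIntegrable_const
    (Eventually.of_forall fun s _ => ?_)
  exact (hG.tendsto (t, s)).comp ((tendsto_gridFloor hT t).prodMk_nhds (tendsto_gridFloor hT s))

theorem tendsto_riemannSum (hT : 0 < T) {F : ℝ → ℝ} (hF : Continuous F) :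
    Tendsto (fun n : ℕ => ∑ i : Fin (n + 1),
        F (T / (n + 1 : ℝ) * (i : ℕ)) * (T / (n + 1 : ℝ))) atTop (𝓝 (∫ t in 0..T, F t)) := by
  refine (tendsto_integral_gridFloor hT hF).congr fun n => ?_
  rw [sum_mul_eq_integral_gridFloor (by positivity)]
  congr 1
  push_cast
  field_simp

theorem tendsto_riemannSum_two (hT : 0 < T) {G : ℝ → ℝ → ℝ}
    (hG : Continuous fun p : ℝ × ℝ => G p.1 p.2) :
    Tendsto (fun n : ℕ => ∑ i : Fin (n + 1), ∑ j : Fin (n + 1),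
        G (T / (n + 1 : ℝ) * (i : ℕ)) (T / (n + 1 : ℝ) * (j : ℕ)) * (T / (n + 1 : ℝ)) *
          (T / (n + 1 : ℝ))) atTop (𝓝 (∫ t in 0..T, ∫ s in 0..T, G t s)) := by
  refine (tendsto_integral_integral_gridFloor hT hG).congr fun n => ?_
  have hn : ((n + 1 : ℕ) : ℝ) * (T / (n + 1 : ℝ)) = T := by push_cast; field_simp
  have hw : 0 < T / (n + 1 : ℝ) := by positivity
  have h := sum_mul_eq_integral_gridFloor hw (n + 1)
    (fun x => ∫ s in 0..T, G x (gridFloor (T / (n + 1 : ℝ)) s))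
  rw [hn] at h
  rw [← h]
  refine Finset.sum_congr rfl fun i _ => ?_
  have h' := sum_mul_eq_integral_gridFloor hw (n + 1)
    (fun s => G (T / (n + 1 : ℝ) * (i : ℕ)) s)
  rw [hn] at h'
  rw [← h', Finset.sum_mul]

end RiemannSums

/-! ### Sub-Gaussian bound for linear functionals of the noise -/

section SubGaussian

namespace RegressionLD

/-- The linear functional `∫₀ᵀ ε(t) f(t) dt` of the noise. -/
noncomputable def noiseIntegral {Ω : Type*} (ε : ℝ → Ω → ℝ) (T : ℝ) (f : ℝ → ℝ) (ω : Ω) : ℝ :=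
  ∫ t in 0..T, ε t ω * f t

theorem noiseIntegral_congr {Ω : Type*} {ε : ℝ → Ω → ℝ} {T : ℝ} (hT : 0 < T) {f f' : ℝ → ℝ} (hf : Set.EqOn f f' (Set.Icc 0 T)) (ω : Ω) :
    noiseIntegral ε T f ω = noiseIntegral ε T f' ω := by
  refine intervalIntegral.integral_congr fun t ht => ?_
  rw [Set.uIcc_of_le hT.le] at ht
  simp only [hf ht]

variable {Ω : Type*} [MeasurableSpace Ω] {P : Measure Ω} {ε : ℝ → Ω → ℝ}

/-- Mean-square continuity says that `t ↦ ε t` is a continuous curve in `L²(P)`, and the covariance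
is the inner product of two points of this curve. -/
theorem IsContinuousNoise.continuous_covFun (h : IsContinuousNoise P ε) :
    Continuous fun p : ℝ × ℝ => covFun P ε p.1 p.2 := by
  set L : ℝ → Lp ℝ 2 P := fun t => (h.memLp_two t).toLp (ε t)
  have hinner : ∀ f g : Lp ℝ 2 P, inner ℝ f g = ∫ ω, f ω * g ω ∂P := fun f g => by
    rw [L2.inner_def]
    refine integral_congr_ae (Eventually.of_forall fun ω => ?_)
    simp [mul_comm]
  have hL : Continuous L := by
    refine continuous_iff_continuousAt.2 fun t => ?_
    rw [ContinuousAt, tendsto_iff_norm_sub_tendsto_zero]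
    have hsq : Tendsto (fun s => ‖L s - L t‖ ^ 2) (𝓝 t) (𝓝 0) := by
      refine (h.meanSquare_continuous t).congr fun s => ?_
      rw [← real_inner_self_eq_norm_sq, hinner]
      refine integral_congr_ae ?_
      filter_upwards [Lp.coeFn_sub (L s) (L t), (h.memLp_two s).coeFn_toLp,
        (h.memLp_two t).coeFn_toLp] with ω h1 h2 h3
      rw [h1, Pi.sub_apply, h2, h3, sq]
    simpa [Real.sqrt_sq (norm_nonneg _)] using hsq.sqrt
  have heq : (fun p : ℝ × ℝ => covFun P ε p.1 p.2) = fun p => inner ℝ (L p.1) (L p.2) := by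
    funext p
    rw [hinner]
    refine integral_congr_ae ?_
    filter_upwards [(h.memLp_two p.1).coeFn_toLp, (h.memLp_two p.2).coeFn_toLp] with ω h1 h2
    rw [h1, h2]
  rw [heq]
  exact (hL.comp continuous_fst).inner (hL.comp continuous_snd)

variable {T : ℝ} {d₀ : ℝ}

/-- The Riemann sums of `∫₀ᵀ ε(t) f(t) dt`. -/
noncomputable def noiseSum (ε : ℝ → Ω → ℝ) (T : ℝ) (f : ℝ → ℝ) (n : ℕ) (ω : Ω) : ℝ :=
  ∑ i : Fin (n + 1), ε (T / (n + 1 : ℝ) * (i : ℕ)) ω *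
    (f (T / (n + 1 : ℝ) * (i : ℕ)) * (T / (n + 1 : ℝ)))

theorem IsContinuousNoise.measurable_noiseSum (h : IsContinuousNoise P ε) (f : ℝ → ℝ) (n : ℕ) :
    Measurable (noiseSum ε T f n) :=
  Finset.measurable_sum _ fun _ _ => (h.measurable _).mul_const _

theorem IsContinuousNoise.tendsto_noiseSum (h : IsContinuousNoise P ε) (hT : 0 < T)
    {f : ℝ → ℝ} (hf : Continuous f) :
    ∀ᵐ ω ∂P, Tendsto (fun n => noiseSum ε T f n ω) atTop (𝓝 (noiseIntegral ε T f ω)) := by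
  filter_upwards [h.ae_continuous] with ω hω
  refine (tendsto_riemannSum hT (hω.mul hf)).congr fun n => ?_
  simp only [noiseSum, Pi.mul_apply, mul_assoc]

/-- The regression increments are continuous only on `[0, T]`; extending them by constants makes the
Riemann sum lemmas applicable. -/
theorem exists_continuous_eqOn (hT : 0 < T) {f : ℝ → ℝ} (hf : ContinuousOn f (Set.Icc 0 T)) :
    ∃ f' : ℝ → ℝ, Continuous f' ∧ Set.EqOn f f' (Set.Icc 0 T) :=
  ⟨Set.IccExtend hT.le ((Set.Icc 0 T).domRestrict f), hf.domRestrict.Icc_extend',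
    fun t ht => by rw [Set.IccExtend_of_mem _ _ ht]; rfl⟩

theorem IsContinuousNoise.aemeasurable_noiseIntegral (h : IsContinuousNoise P ε) (hT : 0 < T)
    {f : ℝ → ℝ} (hf : ContinuousOn f (Set.Icc 0 T)) : AEMeasurable (noiseIntegral ε T f) P := by
  obtain ⟨f', hf', hff'⟩ := exists_continuous_eqOn hT hf
  rw [funext (noiseIntegral_congr (ε := ε) hT hff')]
  exact aemeasurable_of_tendsto_metrizable_ae atTop
    (fun n => (h.measurable_noiseSum f' n).aemeasurable) (h.tendsto_noiseSum hT hf')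

theorem lintegral_exp_noiseSum_le (hsg : IsJointlyStrictlySubGaussian P ε) (f : ℝ → ℝ) (n : ℕ) :
    ∫⁻ ω, ENNReal.ofReal (Real.exp (noiseSum ε T f n ω)) ∂P ≤
      ENNReal.ofReal (Real.exp (1 / 2 * ∑ i : Fin (n + 1), ∑ j : Fin (n + 1),
        covFun P ε (T / (n + 1 : ℝ) * (i : ℕ)) (T / (n + 1 : ℝ) * (j : ℕ)) *
          f (T / (n + 1 : ℝ) * (i : ℕ)) * f (T / (n + 1 : ℝ) * (j : ℕ)) * (T / (n + 1 : ℝ)) *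
          (T / (n + 1 : ℝ)))) := by
  obtain ⟨hint, hle⟩ := hsg (n + 1) (fun i => T / (n + 1 : ℝ) * (i : ℕ))
    (fun i => f (T / (n + 1 : ℝ) * (i : ℕ)) * (T / (n + 1 : ℝ)))
  unfold noiseSum
  rw [← ofReal_integral_eq_lintegral_ofReal hint (Eventually.of_forall fun _ => (Real.exp_pos _).le)]
  refine ENNReal.ofReal_le_ofReal (hle.trans_eq ?_)
  congr 2
  refine Finset.sum_congr rfl fun i _ => Finset.sum_congr rfl fun j _ => ?_
  unfold covFun
  ring

/-- The Riemann sums converge almost surely by path continuity, and their exponential moments are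
controlled by the double Riemann sums of the covariance form. Fatou's lemma gives the limit without
uniform integrability. -/
theorem lintegral_exp_noiseIntegral_le (h : IsContinuousNoise P ε)
    (hsg : IsJointlyStrictlySubGaussian P ε) (hcov : CovarianceBound P ε d₀) (hT : 0 < T)
    {f : ℝ → ℝ} (hf : ContinuousOn f (Set.Icc 0 T)) :
    ∫⁻ ω, ENNReal.ofReal (Real.exp (noiseIntegral ε T f ω)) ∂P ≤
      ENNReal.ofReal (Real.exp (1 / 2 * (d₀ * ∫ t in 0..T, f t ^ 2))) := by
  obtain ⟨f', hf', hff'⟩ := exists_continuous_eqOn hT hf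
  simp_rw [noiseIntegral_congr (ε := ε) hT hff']
  have hsq : ∫ t in 0..T, f t ^ 2 = ∫ t in 0..T, f' t ^ 2 := by
    refine intervalIntegral.integral_congr fun t ht => ?_
    rw [Set.uIcc_of_le hT.le] at ht
    simp only [hff' ht]
  rw [hsq]
  have hmem : MemLp f' 2 (volume.restrict (Set.Icc 0 T)) := by
    obtain ⟨C, hC⟩ := isCompact_Icc.exists_bound_of_continuousOn (s := Set.Icc 0 T)
      hf'.continuousOn
    refine MemLp.of_bound hf'.aestronglyMeasurable C ?_
    filter_upwards [ae_restrict_mem measurableSet_Icc] with t ht using hC t ht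
  have hG : Continuous fun p : ℝ × ℝ => covFun P ε p.1 p.2 * f' p.1 * f' p.2 :=
    (h.continuous_covFun.mul (hf'.comp continuous_fst)).mul (hf'.comp continuous_snd)
  have hlim := tendsto_riemannSum_two (G := fun t s => covFun P ε t s * f' t * f' s) hT hG
  have hexp := (ENNReal.continuous_ofReal.comp Real.continuous_exp).tendsto _ |>.comp
    (hlim.const_mul (1 / 2))
  calc ∫⁻ ω, ENNReal.ofReal (Real.exp (noiseIntegral ε T f' ω)) ∂P
      = ∫⁻ ω, liminf (fun n => ENNReal.ofReal (Real.exp (noiseSum ε T f' n ω))) atTop ∂P := by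
        refine lintegral_congr_ae ?_
        filter_upwards [h.tendsto_noiseSum hT hf'] with ω hω
        exact (((ENNReal.continuous_ofReal.comp Real.continuous_exp).tendsto _).comp
          hω).liminf_eq.symm
    _ ≤ liminf (fun n => ∫⁻ ω, ENNReal.ofReal (Real.exp (noiseSum ε T f' n ω)) ∂P) atTop :=
        lintegral_liminf_le fun n => (h.measurable_noiseSum f' n).exp.ennreal_ofReal
    _ ≤ liminf _ atTop := liminf_le_liminf (Eventually.of_forall fun n =>
        lintegral_exp_noiseSum_le hsg f' n)
    _ = _ := hexp.liminf_eq
    _ ≤ _ := ENNReal.ofReal_le_ofReal (Real.exp_le_exp.2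
        (mul_le_mul_of_nonneg_left (hcov T hT f' hmem) (by norm_num)))

/-- Sub-Gaussian tail of a linear functional of the noise. -/
theorem measure_le_noiseIntegral_le (h : IsContinuousNoise P ε)
    (hsg : IsJointlyStrictlySubGaussian P ε) (hd₀ : 0 < d₀) (hcov : CovarianceBound P ε d₀)
    (hT : 0 < T) {f : ℝ → ℝ} (hf : ContinuousOn f (Set.Icc 0 T)) {V x : ℝ} (hV : 0 < V)
    (hfV : ∫ t in 0..T, f t ^ 2 ≤ V) (hx : 0 ≤ x) :
    P {ω | x ≤ noiseIntegral ε T f ω} ≤ ENNReal.ofReal (Real.exp (-(x ^ 2 / (2 * d₀ * V)))) := by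
  -- The minimizer of the Chernoff exponent `d₀ V l² / 2 - l x`.
  set l : ℝ := x / (d₀ * V)
  have hl : 0 ≤ l := by positivity
  have hlf : ContinuousOn (fun t => l * f t) (Set.Icc 0 T) := hf.const_smul l
  have hint : ∀ ω, noiseIntegral ε T (fun t => l * f t) ω = l * noiseIntegral ε T f ω := fun ω => by
    unfold noiseIntegral
    rw [← intervalIntegral.integral_const_mul]
    congr 1
    funext t
    ring
  have hsq : ∫ t in 0..T, (l * f t) ^ 2 = l ^ 2 * ∫ t in 0..T, f t ^ 2 := by
    rw [← intervalIntegral.integral_const_mul]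
    congr 1
    funext t
    ring
  have hle := lintegral_exp_noiseIntegral_le h hsg hcov hT hlf
  rw [hsq] at hle
  have hmk := mul_meas_ge_le_lintegral₀
    (h.aemeasurable_noiseIntegral hT hlf).exp.ennreal_ofReal (ENNReal.ofReal (Real.exp (l * x)))
  have hsub : {ω | x ≤ noiseIntegral ε T f ω} ⊆ {ω | ENNReal.ofReal (Real.exp (l * x)) ≤
      ENNReal.ofReal (Real.exp (noiseIntegral ε T (fun t => l * f t) ω))} := fun ω hω => by
    refine ENNReal.ofReal_le_ofReal (Real.exp_le_exp.2 ?_)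
    rw [hint]
    exact mul_le_mul_of_nonneg_left hω hl
  have hpos : ENNReal.ofReal (Real.exp (l * x)) ≠ 0 := by
    simpa using Real.exp_pos _
  have hkey : ENNReal.ofReal (Real.exp (l * x)) * P {ω | x ≤ noiseIntegral ε T f ω} ≤
      ENNReal.ofReal (Real.exp (1 / 2 * (d₀ * (l ^ 2 * V)))) := by
    refine ((mul_le_mul_right (measure_mono hsub) _).trans (hmk.trans hle)).trans
      (ENNReal.ofReal_le_ofReal (Real.exp_le_exp.2 ?_))
    gcongr
  rw [mul_comm, ← ENNReal.le_div_iff_mul_le (Or.inl hpos) (Or.inl ENNReal.ofReal_ne_top),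
    ← ENNReal.ofReal_div_of_pos (Real.exp_pos _), ← Real.exp_sub] at hkey
  refine hkey.trans_eq ?_
  congr 2
  simp only [l]
  field_simp
  ring

end RegressionLD

end SubGaussian

/-! ### Nets and chaining -/

section Chaining

namespace RegressionLD

/-- A subset of a ball of radius `M` in `ℝ^q` has an `r`-net of at most `(5 q M / r)^q` points. -/
theorem exists_net {q : ℕ} (hq : 0 < q) {S : Set (Param q)} {M r : ℝ} (hr : 0 < r) (hrM : r ≤ M)
    (hS : ∀ u ∈ S, ‖u‖ ≤ M) :
    ∃ N : Finset (Param q), (∀ v ∈ N, v ∈ S) ∧ (∀ u ∈ S, ∃ v ∈ N, ‖u - v‖ ≤ r) ∧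
      (N.card : ℝ) ≤ (5 * q * M / r) ^ q := by
  classical
  have hq1 : (1 : ℝ) ≤ q := by exact_mod_cast hq
  -- Index of the cubic cell of side `r / q`; two points of one cell are at distance at most `√q · r
  -- / q ≤ r`.
  set c : Param q → Fin q → ℤ := fun u i => ⌊u i / (r / q)⌋
  set m : ℤ := ⌈M * q / r⌉
  have hbox : c '' S ⊆ Fintype.piFinset fun _ : Fin q => Finset.Icc (-m) m := by
    rintro _ ⟨u, hu, rfl⟩
    simp only [Finset.mem_coe, Fintype.mem_piFinset, Finset.mem_Icc]
    intro i
    have hui : |u i| ≤ M := by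
      simpa using (PiLp.norm_apply_le u i).trans (hS u hu)
    have habs : |u i / (r / q)| ≤ M * q / r := by
      rw [abs_div, abs_of_pos (by positivity : (0 : ℝ) < r / q), div_div_eq_mul_div]
      gcongr
    have hm : M * q / r ≤ m := Int.le_ceil _
    obtain ⟨h1, h2⟩ := abs_le.1 (habs.trans hm)
    refine ⟨Int.le_floor.2 (by push_cast; exact h1), ?_⟩
    exact Int.floor_le_iff.2 (lt_of_le_of_lt h2 (by linarith))
  have hfin : (c '' S).Finite := (Finset.finite_toSet _).subset hbox
  -- One representative in `S` per occupied cell: the net must lie in `S`, since the later estimates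
  -- hold only there.
  refine ⟨hfin.toFinset.image (Function.invFunOn c S), ?_, ?_, ?_⟩
  · intro v hv
    simp only [Finset.mem_image, Set.Finite.mem_toFinset] at hv
    obtain ⟨x, hx, rfl⟩ := hv
    exact Function.invFunOn_mem hx
  · intro u hu
    have himg : ∃ a ∈ S, c a = c u := ⟨u, hu, rfl⟩
    refine ⟨Function.invFunOn c S (c u), Finset.mem_image_of_mem _
      (hfin.mem_toFinset.2 ⟨u, hu, rfl⟩), ?_⟩
    set v := Function.invFunOn c S (c u)
    have hcv : c v = c u := Function.invFunOn_eq himg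
    have hcoord : ∀ i, ‖(u - v) i‖ ^ 2 ≤ (r / q) ^ 2 := fun i => by
      have h1 : |u i / (r / q) - v i / (r / q)| < 1 :=
        Int.abs_sub_lt_one_of_floor_eq_floor (congrFun hcv i).symm
      rw [← sub_div, abs_div, abs_of_pos (by positivity : (0 : ℝ) < r / q),
        div_lt_one (by positivity)] at h1
      rw [PiLp.sub_apply, Real.norm_eq_abs]
      exact pow_le_pow_left₀ (abs_nonneg _) h1.le 2
    rw [EuclideanSpace.norm_eq]
    refine Real.sqrt_le_iff.2 ⟨hr.le, (Finset.sum_le_sum fun i _ => hcoord i).trans ?_⟩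
    rw [Finset.sum_const, Finset.card_univ, Fintype.card_fin, nsmul_eq_mul, div_pow,
      mul_div_assoc', div_le_iff₀ (by positivity)]
    nlinarith [mul_nonneg (mul_nonneg (sq_nonneg r) (by linarith : (0 : ℝ) ≤ q))
      (sub_nonneg.2 hq1)]
  · have hcard : hfin.toFinset.card ≤ (2 * m + 1).toNat ^ q := by
      refine (Finset.card_le_card (t := Fintype.piFinset fun _ : Fin q => Finset.Icc (-m) m)
        fun x hx => hbox (hfin.mem_toFinset.1 hx)).trans_eq ?_
      rw [Fintype.card_piFinset]
      simp only [Int.card_Icc, Finset.prod_const, Finset.card_univ, Fintype.card_fin]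
      congr 2
      ring
    have hMr : 1 ≤ M * q / r := by
      rw [le_div_iff₀ hr]
      nlinarith
    have hm : (m : ℝ) < M * q / r + 1 := Int.ceil_lt_add_one _
    have hm0 : 0 ≤ m := Int.ceil_nonneg (by linarith)
    have hnat : (((2 * m + 1).toNat : ℕ) : ℝ) = 2 * m + 1 := by
      rw [← Int.cast_natCast, Int.toNat_of_nonneg (by omega)]
      push_cast
      ring
    calc ((hfin.toFinset.image (Function.invFunOn c S)).card : ℝ)
        ≤ (((2 * m + 1).toNat ^ q : ℕ) : ℝ) := by
          exact_mod_cast Finset.card_image_le.trans hcard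
      _ = (2 * m + 1 : ℝ) ^ q := by rw [Nat.cast_pow, hnat]
      _ ≤ (5 * q * M / r) ^ q := by
          refine pow_le_pow_left₀ (by positivity) ?_ q
          have : 5 * q * M / r = 5 * (M * q / r) := by ring
          linarith

/-- One-sided chaining along a sequence of nets. -/
theorem measure_chaining_le {Ω E : Type*} [MeasurableSpace Ω] [SeminormedAddCommGroup E]
    {P : Measure Ω} {Z : E → Ω → ℝ} {S : Set E} {N : ℕ → Finset E} {r s : ℕ → ℝ} {σ : ℝ}
    {p : ℕ → ENNReal} (hNS : ∀ k, ∀ v ∈ N k, v ∈ S)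
    (hcover : ∀ k, ∀ u ∈ S, ∃ v ∈ N k, ‖u - v‖ ≤ r k)
    (hcont : ∀ᵐ ω ∂P, ∀ u ∈ S, ∀ v : ℕ → E, (∀ k, v k ∈ S) → (∀ k, ‖u - v k‖ ≤ r k) →
      Tendsto (fun k => Z (v k) ω) atTop (𝓝 (Z u ω)))
    (hs : ∀ n, ∑ k ∈ Finset.range n, s k ≤ σ)
    (hp : ∀ k, ∀ x ∈ S, ∀ y ∈ S, ‖x - y‖ ≤ r (k + 1) + r k → P {ω | s k ≤ Z x ω - Z y ω} ≤ p k) :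
    P {ω | ¬ ∀ u ∈ S, ∃ v ∈ N 0, ‖u - v‖ ≤ r 0 ∧ Z u ω - Z v ω ≤ σ} ≤
      ∑' k, ((N (k + 1)).card : ENNReal) * ((N k).card * p k) := by
  -- The events that some close pair from two consecutive nets has a large increment. Outside their
  -- union every chain of net points telescopes to at most `σ`, and `hcont` carries this to the
  -- limit point.
  set B : ℕ → Set Ω := fun k => ⋃ x ∈ N (k + 1), ⋃ y ∈ N k,
    {ω | ‖x - y‖ ≤ r (k + 1) + r k ∧ s k ≤ Z x ω - Z y ω}
  have hpair : ∀ k, ∀ x ∈ N (k + 1), ∀ y ∈ N k,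
      P {ω | ‖x - y‖ ≤ r (k + 1) + r k ∧ s k ≤ Z x ω - Z y ω} ≤ p k := fun k x hx y hy => by
    by_cases hxy : ‖x - y‖ ≤ r (k + 1) + r k
    · simpa [hxy] using hp k x (hNS _ x hx) y (hNS _ y hy) hxy
    · simp [hxy]
  have hB : ∀ k, P (B k) ≤ ((N (k + 1)).card : ENNReal) * ((N k).card * p k) := fun k => by
    refine (measure_biUnion_finset_le _ _).trans ?_
    rw [← nsmul_eq_mul]
    refine Finset.sum_le_card_nsmul _ _ _ fun x hx => (measure_biUnion_finset_le _ _).trans ?_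
    rw [← nsmul_eq_mul]
    exact Finset.sum_le_card_nsmul _ _ _ fun y hy => hpair k x hx y hy
  refine le_trans ?_ ((measure_iUnion_le B).trans (ENNReal.tsum_le_tsum hB))
  refine measure_mono_ae ?_
  filter_upwards [hcont] with ω hω hbad
  by_contra hnB
  refine hbad fun u hu => ?_
  choose v hvN hvr using fun k => hcover k u hu
  refine ⟨v 0, hvN 0, hvr 0, ?_⟩
  have hstep : ∀ k, Z (v (k + 1)) ω - Z (v k) ω ≤ s k := fun k => by
    by_contra! hlt
    refine hnB (Set.mem_iUnion.2 ⟨k, ?_⟩)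
    simp only [B, Set.mem_iUnion]
    refine ⟨v (k + 1), hvN _, v k, hvN _, ?_, hlt.le⟩
    have : v (k + 1) - v k = (u - v k) - (u - v (k + 1)) := by abel
    rw [this]
    exact (norm_sub_le _ _).trans (by linarith [hvr k, hvr (k + 1)])
  have hsum : ∀ n, Z (v n) ω - Z (v 0) ω ≤ σ := fun n => by
    rw [← Finset.sum_range_sub (fun k => Z (v k) ω)]
    exact (Finset.sum_le_sum fun k _ => hstep k).trans (hs n)
  exact le_of_tendsto' ((hω u hu v (fun k => hNS k _ (hvN k)) hvr).sub_const _) hsum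

theorem sq_integral_mul_le {T : ℝ} (hT : 0 < T) {e h : ℝ → ℝ} (he : ContinuousOn e (Set.Icc 0 T))
    (hh : ContinuousOn h (Set.Icc 0 T)) :
    (∫ t in 0..T, e t * h t) ^ 2 ≤ (∫ t in 0..T, e t ^ 2) * ∫ t in 0..T, h t ^ 2 := by
  rw [← Set.uIcc_of_le hT.le] at he hh
  -- Cauchy–Schwarz through the discriminant of `x ↦ ∫ (x e + h)²`.
  have key : ∀ x : ℝ, 0 ≤ (∫ t in 0..T, e t ^ 2) * (x * x) + (2 * ∫ t in 0..T, e t * h t) * x +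
      ∫ t in 0..T, h t ^ 2 := fun x => by
    have h0 : 0 ≤ ∫ t in 0..T, (x * e t + h t) ^ 2 :=
      intervalIntegral.integral_nonneg hT.le fun t _ => sq_nonneg _
    have heq : ∫ t in 0..T, (x * e t + h t) ^ 2 =
        ∫ t in 0..T, ((x * x) * e t ^ 2 + (2 * x) * (e t * h t) + h t ^ 2) :=
      intervalIntegral.integral_congr fun t _ => by ring
    rw [heq, intervalIntegral.integral_add, intervalIntegral.integral_add,
      intervalIntegral.integral_const_mul, intervalIntegral.integral_const_mul] at h0
    · linarith
    · exact (continuousOn_const.mul (he.pow 2)).intervalIntegrable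
    · exact (continuousOn_const.mul (he.mul hh)).intervalIntegrable
    · exact ((continuousOn_const.mul (he.pow 2)).add
        (continuousOn_const.mul (he.mul hh))).intervalIntegrable
    · exact (hh.pow 2).intervalIntegrable
  have := discrim_le_zero key
  unfold discrim at this
  linarith

theorem noiseIntegral_sub {Ω : Type*} {ε : ℝ → Ω → ℝ} {T : ℝ} (hT : 0 < T) {ω : Ω}
    (hω : Continuous fun t => ε t ω) {f f' : ℝ → ℝ} (hf : ContinuousOn f (Set.Icc 0 T))
    (hf' : ContinuousOn f' (Set.Icc 0 T)) :
    noiseIntegral ε T (fun t => f t - f' t) ω =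
      noiseIntegral ε T f ω - noiseIntegral ε T f' ω := by
  rw [← Set.uIcc_of_le hT.le] at hf hf'
  unfold noiseIntegral
  rw [← intervalIntegral.integral_sub]
  · exact intervalIntegral.integral_congr fun t _ => by ring
  · exact (hω.continuousOn.mul hf).intervalIntegrable
  · exact (hω.continuousOn.mul hf').intervalIntegrable

theorem tendsto_noiseIntegral {Ω : Type*} {ε : ℝ → Ω → ℝ} {T : ℝ} (hT : 0 < T) {ω : Ω}
    (hω : Continuous fun t => ε t ω) {f : ℝ → ℝ} {F : ℕ → ℝ → ℝ}
    (hf : ContinuousOn f (Set.Icc 0 T)) (hF : ∀ k, ContinuousOn (F k) (Set.Icc 0 T))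
    (hlim : Tendsto (fun k => ∫ t in 0..T, (f t - F k t) ^ 2) atTop (𝓝 0)) :
    Tendsto (fun k => noiseIntegral ε T (F k) ω) atTop (𝓝 (noiseIntegral ε T f ω)) := by
  have hsq : Tendsto (fun k => (noiseIntegral ε T f ω - noiseIntegral ε T (F k) ω) ^ 2)
      atTop (𝓝 0) := by
    refine squeeze_zero (fun k => sq_nonneg _) (fun k => ?_)
      (by simpa using hlim.const_mul (∫ t in 0..T, ε t ω ^ 2))
    rw [← noiseIntegral_sub hT hω hf (hF k)]
    exact sq_integral_mul_le hT hω.continuousOn (hf.sub (hF k))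
  have habs := hsq.sqrt
  simp only [Real.sqrt_sq_eq_abs, Real.sqrt_zero] at habs
  have h0 := (tendsto_zero_iff_abs_tendsto_zero _).2 habs
  simpa using tendsto_const_nhds (x := noiseIntegral ε T f ω) |>.sub h0

/-- A perturbation of a function that is small in `L₂` lowers the square of its norm little. -/
theorem integral_sq_le_add {T : ℝ} (hT : 0 < T) {e h : ℝ → ℝ} (he : ContinuousOn e (Set.Icc 0 T))
    (hh : ContinuousOn h (Set.Icc 0 T)) :
    ∫ t in 0..T, h t ^ 2 ≤
      17 / 16 * (∫ t in 0..T, e t ^ 2) + 17 * ∫ t in 0..T, (e t - h t) ^ 2 := by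
  rw [← Set.uIcc_of_le hT.le] at he hh
  have h1 : IntervalIntegrable (fun t => 17 / 16 * e t ^ 2) volume 0 T :=
    (continuousOn_const.mul (he.pow 2)).intervalIntegrable
  have h2 : IntervalIntegrable (fun t => 17 * (e t - h t) ^ 2) volume 0 T :=
    (continuousOn_const.mul ((he.sub hh).pow 2)).intervalIntegrable
  rw [← intervalIntegral.integral_const_mul, ← intervalIntegral.integral_const_mul,
    ← intervalIntegral.integral_add h1 h2]
  refine intervalIntegral.integral_mono_on hT.le (hh.pow 2).intervalIntegrable (h1.add h2)
    fun t _ => ?_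
  -- With `d = e - h`, this is `2 |e d| ≤ e² / 16 + 16 d²`.
  nlinarith [sq_nonneg (e t / 4 - 4 * (e t - h t)), sq_nonneg (e t / 4 + 4 * (e t - h t))]

end RegressionLD

end Chaining

/-! ### The exponential bound on a shell -/

section ShellBound

namespace RegressionLD

theorem exists_small_rpow {κ ρ C σ : ℝ} (hκ : 0 < κ) (hρ : 0 < ρ) (hσ : 0 < σ) :
    ∃ h > 0, 2 * h ≤ κ ∧ 2 * h ≤ 1 ∧ C * (2 * h) ^ (2 * ρ) ≤ σ := by
  have hlim : Tendsto (fun h : ℝ => C * (2 * h) ^ (2 * ρ)) (𝓝[>] 0) (𝓝 0) := by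
    have h1 : Tendsto (fun h : ℝ => C * (2 * h) ^ (2 * ρ)) (𝓝 0)
        (𝓝 (C * (2 * 0) ^ (2 * ρ))) :=
      (((continuous_const.mul continuous_id).rpow_const
        fun _ => Or.inr (by positivity)).const_mul C).tendsto 0
    rw [mul_zero, Real.zero_rpow (by positivity), mul_zero] at h1
    exact h1.mono_left nhdsWithin_le_nhds
  have h2 : Tendsto (fun h : ℝ => 2 * h) (𝓝[>] 0) (𝓝 0) := by
    have : Tendsto (fun h : ℝ => 2 * h) (𝓝 0) (𝓝 (2 * 0)) :=
      (continuous_const.mul continuous_id).tendsto 0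
    rw [mul_zero] at this
    exact this.mono_left nhdsWithin_le_nhds
  obtain ⟨h, h3, h4, h5, h6⟩ := ((hlim.eventually_le_const hσ).and
    ((h2.eventually_le_const hκ).and ((h2.eventually_le_const one_pos).and
      self_mem_nhdsWithin))).exists
  exact ⟨h, h6, h4, h5, h3⟩

/-- Starting the net radii at `h / R ^ p'` cancels the polynomial growth `R ^ p`, and shrinking them
by `4 ^ (1/ρ)` per level divides the variance by `16`, because `(4 ^ (1/ρ)) ^ (2ρ) = 16`. -/
theorem polynomial_mul_rpow_le {ρ C σ R x h : ℝ} {p p' k : ℕ} (hρ : 0 < ρ) (hC : 0 ≤ C)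
    (hR : 1 ≤ R) (hp' : (p : ℝ) ≤ 2 * ρ * p') (hh : 0 < h) (hhσ : C * (2 * h) ^ (2 * ρ) ≤ σ)
    (hx0 : 0 ≤ x) (hx : x ≤ 2 * (h / R ^ p' / ((4 : ℝ) ^ (1 / ρ)) ^ k)) :
    C * R ^ p * x ^ (2 * ρ) ≤ σ / 16 ^ k := by
  have hR0 : 0 < R := by linarith
  have hL : (((4 : ℝ) ^ (1 / ρ)) ^ k) ^ (2 * ρ) = 16 ^ k := by
    rw [← Real.rpow_natCast ((4 : ℝ) ^ (1 / ρ)), ← Real.rpow_mul (by positivity),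
      ← Real.rpow_mul (by norm_num)]
    have : 1 / ρ * ((k : ℝ) * (2 * ρ)) = ((2 * k : ℕ) : ℝ) := by
      push_cast
      field_simp
    rw [this, Real.rpow_natCast, pow_mul]
    norm_num
  have hRp : (R : ℝ) ^ p ≤ (R ^ p') ^ (2 * ρ) := by
    rw [← Real.rpow_natCast R p', ← Real.rpow_mul hR0.le, ← Real.rpow_natCast R p]
    exact Real.rpow_le_rpow_of_exponent_le hR (by linarith)
  have hxle : x ^ (2 * ρ) ≤ (2 * h) ^ (2 * ρ) / (R ^ p') ^ (2 * ρ) / 16 ^ k := by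
    rw [← hL, ← Real.div_rpow (by positivity) (by positivity),
      ← Real.div_rpow (by positivity) (by positivity)]
    refine Real.rpow_le_rpow hx0 (hx.trans_eq ?_) (by positivity)
    ring
  calc C * R ^ p * x ^ (2 * ρ)
      ≤ C * (R ^ p') ^ (2 * ρ) * ((2 * h) ^ (2 * ρ) / (R ^ p') ^ (2 * ρ) / 16 ^ k) := by
        gcongr
    _ = C * (2 * h) ^ (2 * ρ) / 16 ^ k := by
        have : 0 < (R ^ p') ^ (2 * ρ) := by positivity
        field_simp
    _ ≤ σ / 16 ^ k := by gcongr

theorem sum_chaining_steps_le {c : ℝ} (hc : 0 ≤ c) (n : ℕ) :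
    ∑ k ∈ Finset.range n, c / 4 / 2 ^ k ≤ c / 2 := by
  have h : ∀ n : ℕ, ∑ k ∈ Finset.range n, c / 4 / 2 ^ k = c / 2 - c / 2 / 2 ^ n := fun n => by
    induction n with
    | zero => simp
    | succ n ih =>
      rw [Finset.sum_range_succ, ih, pow_succ]
      field_simp
      ring
  rw [h]
  have : 0 ≤ c / 2 / 2 ^ n := by positivity
  linarith

/-- Thresholds shrink by `2` and variances by `16` per level, so the exponent equals `A g² 4^k`.
This beats the linear growth `A k` needed to pay for the cardinalities. -/
theorem chaining_exponent_le {d₀ g A : ℝ} (hd₀ : 0 < d₀) (hg : 1 ≤ g) (hA : 1 ≤ A) (k : ℕ) :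
    A * k + g ≤ (d₀ * g / 4 / 2 ^ k) ^ 2 / (2 * d₀ * (d₀ / (32 * A) / 16 ^ k)) := by
  have h16 : (16 : ℝ) ^ k = 2 ^ k * 2 ^ k * (2 ^ k * 2 ^ k) := by
    rw [← mul_pow, ← mul_pow]
    norm_num
  have heq : (d₀ * g / 4 / 2 ^ k) ^ 2 / (2 * d₀ * (d₀ / (32 * A) / 16 ^ k)) =
      A * g ^ 2 * (2 ^ k * 2 ^ k) := by
    rw [h16]
    field_simp
    ring
  have hk : (k : ℝ) + 1 ≤ 2 ^ k * 2 ^ k := by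
    have h1 : (k : ℝ) + 1 ≤ 2 ^ k := by exact_mod_cast Nat.lt_two_pow_self (n := k)
    nlinarith [one_le_pow₀ (n := k) (one_le_two (α := ℝ))]
  rw [heq]
  have hk0 : (0 : ℝ) ≤ k := Nat.cast_nonneg k
  have hg2 : g ≤ g ^ 2 := by nlinarith
  calc A * k + g ≤ A * g ^ 2 * (k + 1) := by
        nlinarith [mul_nonneg (by linarith : (0 : ℝ) ≤ A) (mul_nonneg hk0
          (by nlinarith : (0 : ℝ) ≤ g ^ 2 - 1)), mul_nonneg (sub_nonneg.2 hA) (sq_nonneg g)]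
    _ ≤ A * g ^ 2 * (2 ^ k * 2 ^ k) := by gcongr

/-- Two consecutive nets have at most `M² l ^ (2k+1)` pairs; `A` is chosen so that `exp (-A k)`
removes `l ^ (2k)` and leaves a geometric factor `2 ^ (-k)`. -/
theorem card_mul_exp_le {a b k : ℕ} {M l A g e : ℝ} (hl : 1 ≤ l) (hM : 0 ≤ M)
    (hA : A = 1 + Real.log (2 * (l * l))) (ha : (a : ℝ) ≤ M * l ^ (k + 1)) (hb : (b : ℝ) ≤ M * l ^ k)
    (he : A * k + g ≤ e) :
    (a : ENNReal) * (b * ENNReal.ofReal (Real.exp (-e))) ≤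
      ENNReal.ofReal (M * M * l * Real.exp (-g) * (1 / 2) ^ k) := by
  have hl0 : 0 < l := by linarith
  rw [← ENNReal.ofReal_natCast a, ← ENNReal.ofReal_natCast b,
    ← ENNReal.ofReal_mul (Nat.cast_nonneg b), ← ENNReal.ofReal_mul (Nat.cast_nonneg a)]
  refine ENNReal.ofReal_le_ofReal ?_
  have hA' : Real.exp (-A) ≤ 1 / 2 / (l * l) := by
    rw [hA, neg_add, Real.exp_add, Real.exp_neg (Real.log _), Real.exp_log (by positivity)]
    have : Real.exp (-1) ≤ 1 := Real.exp_le_one_iff.2 (by norm_num)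
    calc Real.exp (-1) * (2 * (l * l))⁻¹ ≤ 1 * (2 * (l * l))⁻¹ := by gcongr
      _ = 1 / 2 / (l * l) := by field_simp
  have hexp : Real.exp (-e) ≤ (1 / 2 / (l * l)) ^ k * Real.exp (-g) := by
    calc Real.exp (-e) ≤ Real.exp (k * (-A) + -g) := Real.exp_le_exp.2 (by linarith)
      _ = Real.exp (-A) ^ k * Real.exp (-g) := by rw [Real.exp_add, Real.exp_nat_mul]
      _ ≤ _ := by gcongr
  calc (a : ℝ) * (b * Real.exp (-e))
      ≤ M * l ^ (k + 1) * (M * l ^ k * ((1 / 2 / (l * l)) ^ k * Real.exp (-g))) := by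
        gcongr
    _ = M * M * l * Real.exp (-g) * (1 / 2) ^ k := by
        rw [div_pow, mul_pow]
        field_simp
        ring

theorem tsum_ofReal_mul_half_pow {c : ℝ} (hc : 0 ≤ c) :
    ∑' k : ℕ, ENNReal.ofReal (c * (1 / 2) ^ k) = ENNReal.ofReal (2 * c) := by
  rw [← ENNReal.ofReal_tsum_of_nonneg (fun k => by positivity)
    (summable_geometric_two.mul_left c), tsum_mul_left, tsum_geometric_two, mul_comm]

variable {Ω : Type*} [MeasurableSpace Ω] {P : Measure Ω} {ε : ℝ → Ω → ℝ} {d₀ : ℝ} {q : ℕ}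

/-- The event at `u` forces, at a nearby point `v` of the coarsest net, the noise to exceed `3/8` of
the squared norm, unless a chaining increment exceeds `d₀ g / 2`. The first has rate `(3/8)² · 8 / 2
= 9/16`, the second rate `1`; `C` and `p` depend on neither `T`, `g` nor the family `f`. -/
theorem measure_exists_integral_sq_le_noiseIntegral (hN : IsContinuousNoise P ε)
    (hsg : IsJointlyStrictlySubGaussian P ε) (hd₀ : 0 < d₀) (hcov : CovarianceBound P ε d₀)
    (hq : 0 < q) {κ ρ C₁ : ℝ} (hκ : 0 < κ) (hρ : 0 < ρ) (hC₁ : 0 ≤ C₁) (p₁ : ℕ) :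
    ∃ C > 0, ∃ p : ℕ, ∀ T > 0, ∀ R ≥ 1, ∀ g ≥ 1, ∀ (S : Set (Param q)) (f : Param q → ℝ → ℝ),
      (∀ u ∈ S, ‖u‖ ≤ R + 1) → (∀ u ∈ S, ContinuousOn (f u) (Set.Icc 0 T)) →
      (∀ u ∈ S, 8 * d₀ * g ≤ ∫ t in 0..T, f u t ^ 2) →
      (∀ u ∈ S, ∀ v ∈ S, ‖u - v‖ ≤ κ →
        ∫ t in 0..T, (f u t - f v t) ^ 2 ≤ C₁ * R ^ p₁ * ‖u - v‖ ^ (2 * ρ)) →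
      P {ω | ∃ u ∈ S, ∫ t in 0..T, f u t ^ 2 ≤ 2 * noiseIntegral ε T (f u) ω} ≤
        ENNReal.ofReal (C * R ^ p * Real.exp (-(9 / 16 * g))) := by
  have hq1 : (1 : ℝ) ≤ q := by exact_mod_cast hq
  set L : ℝ := (4 : ℝ) ^ (1 / ρ) with hL
  have hL1 : 1 ≤ L := Real.one_le_rpow (by norm_num) (by positivity)
  set l : ℝ := L ^ q
  have hl1 : 1 ≤ l := one_le_pow₀ hL1
  set A : ℝ := 1 + Real.log (2 * (l * l)) with hA
  have hA1 : 1 ≤ A := by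
    have : 0 ≤ Real.log (2 * (l * l)) := Real.log_nonneg (by nlinarith)
    linarith
  set σ : ℝ := d₀ / (32 * A) with hσ
  have hσ0 : 0 < σ := by positivity
  have hσd : σ ≤ d₀ / 32 := div_le_div_of_nonneg_left hd₀.le (by norm_num) (by linarith)
  obtain ⟨p₂, hp₂⟩ := exists_nat_ge ((p₁ : ℝ) / (2 * ρ))
  rw [div_le_iff₀ (by positivity), mul_comm] at hp₂
  obtain ⟨h₀, hh₀, hhκ, hh1, hhσ⟩ := exists_small_rpow (C := C₁) hκ hρ hσ0
  -- The `10` is the `5` of `exists_net` doubled, as `R + 1 ≤ 2 R`.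
  set M₀ : ℝ := (10 * q / h₀) ^ q
  have hM₀ : 0 < M₀ := by positivity
  refine ⟨M₀ + 2 * (M₀ * M₀ * l), by positivity, 2 * ((1 + p₂) * q), ?_⟩
  intro T hT R hR g hg S f hSR hfc hfg hfh
  have hR0 : 0 < R := by linarith
  set r : ℕ → ℝ := fun k => h₀ / R ^ p₂ / L ^ k
  have hr0 : ∀ k, 0 < r k := fun k => by positivity
  have hrh : ∀ k, r k ≤ h₀ := fun k =>
    (div_le_self (by positivity) (one_le_pow₀ hL1)).trans
      (div_le_self hh₀.le (one_le_pow₀ hR))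
  have hrmono : ∀ k, r (k + 1) ≤ r k := fun k =>
    div_le_div_of_nonneg_left (by positivity) (by positivity)
      (pow_le_pow_right₀ hL1 (Nat.le_succ k))
  have hinc : ∀ k, ∀ u ∈ S, ∀ v ∈ S, ‖u - v‖ ≤ 2 * r k →
      ∫ t in 0..T, (f u t - f v t) ^ 2 ≤ σ / 16 ^ k := fun k u hu v hv huv =>
    (hfh u hu v hv (by linarith [hrh k])).trans
      (polynomial_mul_rpow_le hρ hC₁ hR hp₂ hh₀ hhσ (norm_nonneg _) huv)
  choose N hNS hcover hcard using fun k =>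
    exists_net hq (hr0 k) (by linarith [hrh k] : r k ≤ R + 1) hSR
  set M : ℝ := M₀ * R ^ ((1 + p₂) * q)
  have hM : 0 ≤ M := by positivity
  have hcardM : ∀ k, ((N k).card : ℝ) ≤ M * l ^ k := fun k => by
    refine (hcard k).trans ?_
    have : M * l ^ k = (10 * q / h₀ * R ^ (1 + p₂) * L ^ k) ^ q := by
      simp only [M, M₀, l]
      rw [mul_pow, mul_pow, ← pow_mul R, ← pow_mul L, ← pow_mul L, mul_comm k q]
    rw [this]
    refine pow_le_pow_left₀ (by positivity) ?_ q
    have heq : 5 * q * (R + 1) / r k = 5 * q / h₀ * (R + 1) * R ^ p₂ * L ^ k := by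
      simp only [r]
      field_simp
    have heq' : 10 * q / h₀ * R ^ (1 + p₂) * L ^ k =
        5 * q / h₀ * (2 * R) * R ^ p₂ * L ^ k := by
      rw [pow_add, pow_one]
      ring
    rw [heq, heq']
    gcongr
    linarith
  have hcont : ∀ᵐ ω ∂P, ∀ u ∈ S, ∀ v : ℕ → Param q, (∀ k, v k ∈ S) → (∀ k, ‖u - v k‖ ≤ r k) →
      Tendsto (fun k => noiseIntegral ε T (f (v k)) ω) atTop (𝓝 (noiseIntegral ε T (f u) ω)) := by
    filter_upwards [hN.ae_continuous] with ω hω u hu v hv huv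
    refine tendsto_noiseIntegral hT hω (hfc u hu) (fun k => hfc _ (hv k)) ?_
    refine squeeze_zero (fun k => intervalIntegral.integral_nonneg hT.le fun t _ => sq_nonneg _)
      (fun k => hinc k u hu _ (hv k) (by linarith [huv k, hr0 k])) ?_
    exact tendsto_const_nhds.div_atTop (tendsto_pow_atTop_atTop_of_one_lt (by norm_num))
  have hstep : ∀ k, ∀ x ∈ S, ∀ y ∈ S, ‖x - y‖ ≤ r (k + 1) + r k →
      P {ω | d₀ * g / 4 / 2 ^ k ≤ noiseIntegral ε T (f x) ω - noiseIntegral ε T (f y) ω} ≤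
        ENNReal.ofReal (Real.exp
          (-((d₀ * g / 4 / 2 ^ k) ^ 2 / (2 * d₀ * (d₀ / (32 * A) / 16 ^ k))))) := by
    intro k x hx y hy hxy
    refine le_trans (measure_mono_ae ?_) (measure_le_noiseIntegral_le hN hsg hd₀ hcov hT
      ((hfc x hx).sub (hfc y hy)) (by positivity)
      (hinc k x hx y hy (by linarith [hrmono k])) (by positivity))
    filter_upwards [hN.ae_continuous] with ω hω hle
    change _ ≤ noiseIntegral ε T (fun t => f x t - f y t) ω
    rw [noiseIntegral_sub hT hω (hfc x hx) (hfc y hy)]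
    exact hle
  have hchain := measure_chaining_le (P := P) hNS hcover hcont
    (sum_chaining_steps_le (by positivity : 0 ≤ d₀ * g)) hstep
  have htsum : ∑' k, ((N (k + 1)).card : ENNReal) * ((N k).card * ENNReal.ofReal (Real.exp
      (-((d₀ * g / 4 / 2 ^ k) ^ 2 / (2 * d₀ * (d₀ / (32 * A) / 16 ^ k)))))) ≤
        ENNReal.ofReal (2 * (M * M * l * Real.exp (-g))) := by
    rw [← tsum_ofReal_mul_half_pow (by positivity)]
    exact ENNReal.tsum_le_tsum fun k => card_mul_exp_le hl1 hM hA (hcardM (k + 1)) (hcardM k)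
      (chaining_exponent_le hd₀ hg hA1 k)
  have hnet : P (⋃ v ∈ N 0, {ω | 3 / 8 * (∫ t in 0..T, f v t ^ 2) ≤ noiseIntegral ε T (f v) ω}) ≤
      ENNReal.ofReal (M * Real.exp (-(9 / 16 * g))) := by
    refine (measure_biUnion_finset_le _ _).trans ((Finset.sum_le_card_nsmul _ _
      (ENNReal.ofReal (Real.exp (-(9 / 16 * g)))) fun v hv => ?_).trans ?_)
    · have hv' := hfg v (hNS 0 v hv)
      have hpos : 0 < ∫ t in 0..T, f v t ^ 2 := lt_of_lt_of_le (by positivity) hv'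
      refine (measure_le_noiseIntegral_le hN hsg hd₀ hcov hT (hfc v (hNS 0 v hv)) hpos le_rfl
        (by positivity)).trans (ENNReal.ofReal_le_ofReal (Real.exp_le_exp.2 (neg_le_neg ?_)))
      rw [le_div_iff₀ (by positivity)]
      nlinarith
    · rw [nsmul_eq_mul, ← ENNReal.ofReal_natCast, ← ENNReal.ofReal_mul (Nat.cast_nonneg _)]
      refine ENNReal.ofReal_le_ofReal ?_
      have := hcardM 0
      rw [pow_zero, mul_one] at this
      gcongr
  have hsub : {ω | ∃ u ∈ S, ∫ t in 0..T, f u t ^ 2 ≤ 2 * noiseIntegral ε T (f u) ω} ⊆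
      (⋃ v ∈ N 0, {ω | 3 / 8 * (∫ t in 0..T, f v t ^ 2) ≤ noiseIntegral ε T (f v) ω}) ∪
        {ω | ¬ ∀ u ∈ S, ∃ v ∈ N 0, ‖u - v‖ ≤ r 0 ∧
          noiseIntegral ε T (f u) ω - noiseIntegral ε T (f v) ω ≤ d₀ * g / 2} := by
    rintro ω ⟨u, hu, hle⟩
    by_contra hnot
    simp only [Set.mem_union, not_or, Set.mem_ofPred_eq, not_not] at hnot
    obtain ⟨v, hv, huv, hZ⟩ := hnot.2 u hu
    refine hnot.1 (Set.mem_iUnion₂.2 ⟨v, hv, ?_⟩)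
    have hD := hinc 0 u hu v (hNS 0 v hv) (by linarith [hr0 0])
    rw [pow_zero, div_one] at hD
    have hW := integral_sq_le_add hT (hfc u hu) (hfc v (hNS 0 v hv))
    have hm := hfg v (hNS 0 v hv)
    have hdg : d₀ ≤ d₀ * g := le_mul_of_one_le_right hd₀.le hg
    change 3 / 8 * (∫ t in 0..T, f v t ^ 2) ≤ noiseIntegral ε T (f v) ω
    -- `noise v ≥ W u / 2 - d₀ g / 2` and `W v ≤ 17/16 W u + 17 d₀ / 32` give `noise v ≥ 8/17 W v -
    -- 3/4 d₀ g`. Since `d₀ g ≤ W v / 8`, this is at least `(8/17 - 3/32) W v`, and `8/17 - 3/32 >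
    -- 3/8`.
    linarith
  refine (measure_mono hsub).trans ((measure_union_le _ _).trans
    ((add_le_add hnet (hchain.trans htsum)).trans ?_))
  rw [← ENNReal.ofReal_add (by positivity) (by positivity)]
  refine ENNReal.ofReal_le_ofReal ?_
  have hexp : Real.exp (-g) ≤ Real.exp (-(9 / 16 * g)) := Real.exp_le_exp.2 (by linarith)
  have hRR : R ^ ((1 + p₂) * q) ≤ R ^ (2 * ((1 + p₂) * q)) := pow_le_pow_right₀ hR (by omega)
  have hMle : M ≤ M₀ * R ^ (2 * ((1 + p₂) * q)) := mul_le_mul_of_nonneg_left hRR hM₀.le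
  calc M * Real.exp (-(9 / 16 * g)) + 2 * (M * M * l * Real.exp (-g))
      ≤ M₀ * R ^ (2 * ((1 + p₂) * q)) * Real.exp (-(9 / 16 * g)) +
          2 * (M * M * l * Real.exp (-(9 / 16 * g))) := by gcongr
    _ = _ := by
        simp only [M]
        rw [two_mul ((1 + p₂) * q), pow_add R]
        ring

end RegressionLD

end ShellBound

/-! ### The regression model -/

section RegressionModel

namespace RegressionLD

theorem exists_polynomial_eval_le (γ : Polynomial ℝ) :
    ∃ C ≥ 0, ∃ p : ℕ, ∀ R ≥ 1, γ.eval R ≤ C * R ^ p := by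
  refine ⟨∑ i ∈ Finset.range (γ.natDegree + 1), |γ.coeff i|,
    Finset.sum_nonneg fun _ _ => abs_nonneg _, γ.natDegree, fun R hR => ?_⟩
  rw [Polynomial.eval_eq_sum_range, Finset.sum_mul]
  have hR0 : 0 ≤ R := zero_le_one.trans hR
  refine Finset.sum_le_sum fun i hi => ?_
  have hpow : R ^ i ≤ R ^ γ.natDegree :=
    pow_le_pow_right₀ hR (Nat.lt_succ_iff.1 (Finset.mem_range.1 hi))
  exact (mul_le_mul_of_nonneg_right (le_abs_self _) (pow_nonneg hR0 i)).trans
    (mul_le_mul_of_nonneg_left hpow (abs_nonneg _))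

variable {q : ℕ} {Θ : Set (Param q)} {a : ℝ → Param q → ℝ} {θ : Param q} {T R : ℝ}

theorem diagMul_smul (c : Fin q → ℝ) (k : ℝ) (x : Param q) :
    diagMul c (k • x) = k • diagMul c x := by
  ext i
  simp only [diagMul, PiLp.smul_apply, smul_eq_mul]
  ring

theorem continuous_diagMul (c : Fin q → ℝ) : Continuous (diagMul c) :=
  (PiLp.continuous_toLp 2 _).comp (by fun_prop)

theorem norm_diagMul_le {c c' : Fin q → ℝ} (h0 : ∀ i, 0 ≤ c i) (h : ∀ i, c i ≤ c' i)
    (x : Param q) : ‖diagMul c x‖ ≤ ‖diagMul c' x‖ := by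
  rw [EuclideanSpace.norm_eq, EuclideanSpace.norm_eq]
  refine Real.sqrt_le_sqrt (Finset.sum_le_sum fun i _ => ?_)
  simp only [diagMul, norm_mul, Real.norm_eq_abs]
  rw [abs_of_nonneg (h0 i), abs_of_nonneg ((h0 i).trans (h i))]
  exact pow_le_pow_left₀ (mul_nonneg (h0 i) (abs_nonneg _))
    (mul_le_mul_of_nonneg_right (h i) (abs_nonneg _)) 2

theorem NormingWellDefined.dEntry_pos (h : NormingWellDefined a T θ) (i : Fin q) :
    0 < dEntry a T θ i := Real.sqrt_pos.2 (h i).2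

theorem NormingWellDefined.dInvMul_dMul (h : NormingWellDefined a T θ) (x : Param q) :
    dInvMul a T θ (dMul a T θ x) = x := by
  ext i
  simp only [dInvMul, dMul, diagMul]
  rw [inv_mul_cancel_left₀ (h.dEntry_pos i).ne']

theorem NormingWellDefined.norm_dMul_mono {T' : ℝ} (h : NormingWellDefined a T' θ) (hT : 0 ≤ T)
    (hTT' : T ≤ T') (x : Param q) : ‖dMul a T θ x‖ ≤ ‖dMul a T' θ x‖ :=
  norm_diagMul_le (fun _ => Real.sqrt_nonneg _) (fun i => Real.sqrt_le_sqrt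
    (intervalIntegral.integral_mono_interval le_rfl hT hTT'
      (Eventually.of_forall fun _ => sq_nonneg _) (h i).1)) x

theorem NormingWellDefined.add_dInvMul_mem (h : NormingWellDefined a T θ) {u : Param q}
    (hu : u ∈ normedSet a Θ T θ) : θ + dInvMul a T θ u ∈ closure Θ := by
  obtain ⟨τ, hτ, rfl⟩ := hu
  simpa [h.dInvMul_dMul] using hτ

theorem increment_dMul (h : NormingWellDefined a T θ) (t : ℝ) (τ : Param q) :
    increment a T θ t (dMul a T θ (τ - θ)) = a t τ - a t θ := by
  simp [increment, h.dInvMul_dMul]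

theorem Phi_zero_right (u : Param q) :
    Phi a T θ u 0 = ∫ t in 0..T, increment a T θ t u ^ 2 := by
  have h0 : dInvMul a T θ 0 = 0 := by
    ext i
    simp [dInvMul, diagMul]
  simp [Phi, increment, h0]

theorem IsRegressionFunction.continuousOn_apply (ha : IsRegressionFunction Θ a) {τ : Param q}
    (hτ : τ ∈ closure Θ) : ContinuousOn (fun t => a t τ) (Set.Icc 0 T) :=
  ha.continuousOn.comp (f := fun t : ℝ => (t, τ)) (by fun_prop) fun _ ht => ⟨ht.1, hτ⟩

theorem IsRegressionFunction.continuousOn_increment (ha : IsRegressionFunction Θ a)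
    (hθ : θ ∈ Θ) (h : NormingWellDefined a T θ) {u : Param q} (hu : u ∈ normedSet a Θ T θ) :
    ContinuousOn (fun t => increment a T θ t u) (Set.Icc 0 T) :=
  (ha.continuousOn_apply (h.add_dInvMul_mem hu)).sub (ha.continuousOn_apply (subset_closure hθ))

theorem smul_mem_normedSet (hΘ : Convex ℝ Θ) (hθ : θ ∈ Θ) {u : Param q}
    (hu : u ∈ normedSet a Θ T θ) {c : ℝ} (hc0 : 0 ≤ c) (hc1 : c ≤ 1) :
    c • u ∈ normedSet a Θ T θ := by
  obtain ⟨τ, hτ, rfl⟩ := hu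
  refine ⟨θ + c • (τ - θ), hΘ.closure.add_smul_sub_mem (subset_closure hθ) hτ ⟨hc0, hc1⟩, ?_⟩
  simp only [add_sub_cancel_left, dMul, diagMul_smul]

/-- Convexity makes the normed set star-shaped about `0`, so a far point can be scaled back to norm
exactly `R`. -/
theorem shell_nonempty_of_le_norm (hΘ : Convex ℝ Θ) (hθ : θ ∈ Θ) (hR : 0 < R) {u : Param q}
    (hu : u ∈ normedSet a Θ T θ) (hRu : R ≤ ‖u‖) : (shell a Θ T θ R).Nonempty := by
  have hu0 : 0 < ‖u‖ := hR.trans_le hRu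
  have hnorm : ‖(R / ‖u‖) • u‖ = R := by
    rw [norm_smul, Real.norm_of_nonneg (by positivity), div_mul_cancel₀ _ hu0.ne']
  exact ⟨(R / ‖u‖) • u, smul_mem_normedSet hΘ hθ hu (by positivity) ((div_le_one hu0).2 hRu),
    hnorm.ge, by rw [hnorm]; linarith⟩

variable {Ω : Type*} [MeasurableSpace Ω] {P : Measure Ω} {ε : ℝ → Ω → ℝ} {d₀ : ℝ}

/-- The basic inequality for a least squares estimator. -/
theorem IsLSE.ae_integral_increment_sq_le (hN : IsContinuousNoise P ε)
    (ha : IsRegressionFunction Θ a) (hT : 0 < T) (hθ : θ ∈ Θ) (h : NormingWellDefined a T θ)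
    {θhat : Ω → Param q} (hLSE : IsLSE P a ε Θ θ T θhat) :
    ∀ᵐ ω ∂P, dMul a T θ (θhat ω - θ) ∈ normedSet a Θ T θ ∧
      ∫ t in 0..T, increment a T θ t (dMul a T θ (θhat ω - θ)) ^ 2 ≤
        2 * noiseIntegral ε T (fun t => increment a T θ t (dMul a T θ (θhat ω - θ))) ω := by
  filter_upwards [hN.ae_continuous, hLSE.mem_closure, hLSE.isMinOn] with ω hω hmem hmin
  refine ⟨⟨θhat ω, hmem, rfl⟩, ?_⟩
  have hle : lsFunctional a ε θ T ω (θhat ω) ≤ lsFunctional a ε θ T ω θ :=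
    hmin (subset_closure hθ)
  simp only [increment_dMul h, noiseIntegral]
  have hc1 := ha.continuousOn_apply (T := T) hmem
  have hc2 := ha.continuousOn_apply (T := T) (subset_closure hθ)
  rw [← Set.uIcc_of_le hT.le] at hc1 hc2
  have hc := hc1.sub hc2
  have hsplit : lsFunctional a ε θ T ω (θhat ω) = (∫ t in 0..T, ε t ω ^ 2) -
      2 * (∫ t in 0..T, ε t ω * (a t (θhat ω) - a t θ)) +
        ∫ t in 0..T, (a t (θhat ω) - a t θ) ^ 2 := by
    rw [← intervalIntegral.integral_const_mul, ← intervalIntegral.integral_sub,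
      ← intervalIntegral.integral_add]
    · exact intervalIntegral.integral_congr fun t _ => by
        simp only [observation]
        ring
    · exact ((hω.continuousOn.pow 2).sub
        (continuousOn_const.mul (hω.continuousOn.mul hc))).intervalIntegrable
    · exact (hc.pow 2).intervalIntegrable
    · exact (hω.continuousOn.pow 2).intervalIntegrable
    · exact (continuousOn_const.mul (hω.continuousOn.mul hc)).intervalIntegrable
  have htrue : lsFunctional a ε θ T ω θ = ∫ t in 0..T, ε t ω ^ 2 :=
    intervalIntegral.integral_congr fun t _ => by simp [observation]
  linarith

theorem exists_nat_mem_shell {u : Param q} (hu : u ∈ normedSet a Θ T θ)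
    (hRu : R ≤ ‖u‖) : ∃ k : ℕ, u ∈ shell a Θ T θ (R + k) := by
  have h1 := Nat.floor_le (sub_nonneg.2 hRu)
  have h2 := Nat.lt_floor_add_one (‖u‖ - R)
  exact ⟨⌊‖u‖ - R⌋₊, hu, by linarith, by linarith⟩

/-- The gap `9/16 - 1/2 = 1/16` in the rate absorbs `x ^ (p + 2)`, by taking a 16th root in the
hypothesis on `g`. -/
theorem pow_mul_exp_le {p : ℕ} {C x g b : ℝ} (hC : 0 ≤ C) (hx : 1 ≤ x) (hb : b ≤ 1 / 2)
    (hg : 0 ≤ g) (hxg : x ^ (16 * (p + 2)) * Real.exp (-g) ≤ 1) :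
    C * x ^ p * Real.exp (-(9 / 16 * g)) ≤ C * Real.exp (-(b * g)) * (1 / x ^ 2) := by
  have hx0 : 0 < x := by linarith
  have hroot : x ^ (p + 2) * Real.exp (-(g / 16)) ≤ 1 := by
    rw [← pow_le_one_iff_of_nonneg (by positivity) (by norm_num : 16 ≠ 0), mul_pow, ← pow_mul,
      ← Real.exp_nat_mul]
    have h1 : (p + 2) * 16 = 16 * (p + 2) := mul_comm _ _
    have h2 : ((16 : ℕ) : ℝ) * -(g / 16) = -g := by
      push_cast
      ring
    rwa [h1, h2]
  have hexp : Real.exp (-(9 / 16 * g)) ≤ Real.exp (-(b * g)) * Real.exp (-(g / 16)) := by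
    rw [← Real.exp_add]
    exact Real.exp_le_exp.2 (by nlinarith)
  calc C * x ^ p * Real.exp (-(9 / 16 * g))
      ≤ C * x ^ p * (Real.exp (-(b * g)) * Real.exp (-(g / 16))) := by gcongr
    _ = C * Real.exp (-(b * g)) * (x ^ (p + 2) * Real.exp (-(g / 16))) / x ^ 2 := by
        rw [pow_add]
        field_simp
    _ ≤ C * Real.exp (-(b * g)) * 1 / x ^ 2 := by gcongr
    _ = C * Real.exp (-(b * g)) * (1 / x ^ 2) := by ring

theorem summable_one_div_succ_sq : Summable fun k : ℕ => 1 / ((k : ℝ) + 1) ^ 2 := by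
  have := (summable_nat_add_iff 1).2 (Real.summable_one_div_nat_pow.2 one_lt_two)
  simpa using this

/-- The bound `exp (-1)` instead of `1` also yields `g ≥ 1` once `R ≥ 1`, as the chaining requires.
-/
theorem IsClassG.exists_pow_mul_exp_le {g : ℝ → ℝ → ℝ} (hg : IsClassG g) {r : ℕ} (hr : 0 < r) :
    ∃ T₁ R₁ : ℝ, ∀ T ≥ T₁, ∀ R ≥ R₁, R ^ r * Real.exp (-g T R) ≤ Real.exp (-1) := by
  have h := (hg.tendsto_zero r (by exact_mod_cast hr)).eventually_le_const (Real.exp_pos (-1))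
  rw [prod_atTop_atTop_eq, eventually_atTop] at h
  obtain ⟨⟨T₁, R₁⟩, h⟩ := h
  exact ⟨T₁, R₁, fun T hT R hR => by simpa using h (T, R) ⟨hT, hR⟩⟩

theorem exists_uniform_deviationBound (hq : 0 < q)
    (ha : IsRegressionFunction Θ a) (hN : IsContinuousNoise P ε)
    (hsg : IsJointlyStrictlySubGaussian P ε) (hd₀ : 0 < d₀) (hcov : CovarianceBound P ε d₀)
    {g : ℝ → ℝ → ℝ} (hg : IsClassG g) {δ κ ρ : ℝ} (hδ : δ ∈ Set.Ioo (0 : ℝ) (1 / 2))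
    (hκ : 0 < κ) (hρ : 0 < ρ) {γ₁ : Polynomial ℝ} {T₀ R₀ b : ℝ} (hT₀ : 0 ≤ T₀)
    (hb0 : 0 ≤ b) (hb : b ≤ 1 / 2) {K : Set (Param q)} (hK : K ⊆ Θ)
    (hd : ∀ θ ∈ K, ∀ T > T₀, NormingWellDefined a T θ)
    (hR1i : ∀ θ ∈ K, ∀ T > T₀, ∀ R > R₀, CondR1i a Θ γ₁ κ ρ θ T R)
    (hR2 : ∀ θ ∈ K, ∀ T > T₀, ∀ R > R₀, CondR2 a Θ g d₀ δ θ T R) :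
    ∃ T₁ ≥ T₀, ∃ R₁ ≥ R₀, ∃ B₀ > 0, ∀ θ ∈ K, ∀ T > T₁, ∀ R > R₁,
      LSEDeviationBound P a ε Θ g B₀ b θ T R := by
  obtain ⟨C₁, hC₁, p₁, hγ₁⟩ := exists_polynomial_eval_le γ₁
  obtain ⟨C, hC, p, hbound⟩ :=
    measure_exists_integral_sq_le_noiseIntegral hN hsg hd₀ hcov hq hκ hρ hC₁ p₁
  obtain ⟨T₂, R₂, hgexp⟩ := hg.exists_pow_mul_exp_le (r := 16 * (p + 2)) (by positivity)
  have hsumpos : 0 ≤ ∑' k : ℕ, 1 / ((k : ℝ) + 1) ^ 2 := tsum_nonneg fun k => by positivity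
  refine ⟨max T₀ T₂, le_max_left _ _, max R₀ (max R₂ 1), le_max_left _ _,
    C * ∑' k : ℕ, 1 / ((k : ℝ) + 1) ^ 2 + 1, by positivity, ?_⟩
  intro θ hθ T hT R hR θhat hLSE
  obtain ⟨hTT₀, hTT₂⟩ := max_lt_iff.1 hT
  obtain ⟨hRR₀, hR'⟩ := max_lt_iff.1 hR
  obtain ⟨hRR₂, hR1⟩ := max_lt_iff.1 hR'
  have hT0 : 0 < T := hT₀.trans_lt hTT₀
  have hwd := hd θ hθ T hTT₀
  set E : ℕ → Set Ω := fun k => {ω | ∃ u ∈ shell a Θ T θ (R + k),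
    ∫ t in 0..T, increment a T θ t u ^ 2 ≤
      2 * noiseIntegral ε T (fun t => increment a T θ t u) ω}
  have hE : ∀ k : ℕ, P (E k) ≤
      ENNReal.ofReal (C * Real.exp (-(b * g T R)) * (1 / ((k : ℝ) + 1) ^ 2)) := fun k => by
    set x : ℝ := R + k
    have hk : (0 : ℝ) ≤ k := Nat.cast_nonneg k
    have hRx : R ≤ x := by linarith
    have hx1 : 1 ≤ x := by linarith
    have hxR₀ : x > R₀ := by linarith
    have hgx := hgexp T hTT₂.le x (by linarith)
    have hpow1 : (1 : ℝ) ≤ x ^ (16 * (p + 2)) := one_le_pow₀ hx1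
    have hg1 : 1 ≤ g T x := by
      have := (le_mul_of_one_le_left (Real.exp_pos _).le hpow1).trans hgx
      linarith [Real.exp_le_exp.1 this]
    -- Monotonicity lets all outer shells be bounded with the rate of the innermost one.
    have hgmono : g T R ≤ g T x :=
      hg.monotoneOn T hT0 (Set.mem_Ioi.2 (by linarith)) (Set.mem_Ioi.2 (by linarith)) hRx
    -- The only use of `δ < 1/2`: it turns (R2) into the lower bound `8 d₀ g`.
    have hδ4 : 4 ≤ (δ ^ 2)⁻¹ := by
      rw [le_inv_comm₀ (by norm_num) (pow_pos hδ.1 2)]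
      nlinarith [hδ.1, hδ.2]
    refine (hbound T hT0 x hx1 (g T x) hg1 (shell a Θ T θ x) (fun u t => increment a T θ t u)
      (fun u hu => hu.2.2) (fun u hu => ha.continuousOn_increment (hK hθ) hwd hu.1)
      (fun u hu => ?_) (fun u hu v hv huv => ?_)).trans
      (ENNReal.ofReal_le_ofReal ((pow_mul_exp_le hC.le hx1 hb (by linarith)
        (hgx.trans (Real.exp_le_one_iff.2 (by norm_num)))).trans ?_))
    · rw [← Phi_zero_right]
      refine le_trans ?_ (hR2 θ hθ T hTT₀ x hxR₀ u hu)
      have : 2 * d₀ * 4 ≤ 2 * d₀ * (δ ^ 2)⁻¹ := by gcongr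
      nlinarith
    · refine (hR1i θ hθ T hTT₀ x hxR₀ u hu v hv huv).trans ?_
      gcongr
      exact hγ₁ x hx1
    · have : (k : ℝ) + 1 ≤ x := by linarith
      gcongr
  have hsub : P {ω | R ≤ ‖dMul a T θ (θhat ω - θ)‖} ≤ P (⋃ k, E k) := by
    refine measure_mono_ae ?_
    filter_upwards [hLSE.ae_integral_increment_sq_le hN ha hT0 (hK hθ) hwd] with ω hω hle
    obtain ⟨k, hk⟩ := exists_nat_mem_shell hω.1 hle
    exact Set.mem_iUnion.2 ⟨k, _, hk, hω.2⟩
  have htotal : P {ω | R ≤ ‖dMul a T θ (θhat ω - θ)‖} ≤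
      ENNReal.ofReal (C * Real.exp (-(b * g T R)) * ∑' k : ℕ, 1 / ((k : ℝ) + 1) ^ 2) := by
    refine hsub.trans ((measure_iUnion_le E).trans ((ENNReal.tsum_le_tsum hE).trans_eq ?_))
    rw [← ENNReal.ofReal_tsum_of_nonneg (fun k => by positivity)
      (summable_one_div_succ_sq.mul_left _), tsum_mul_left]
  refine (ENNReal.toReal_le_of_le_ofReal (by positivity) htotal).trans ?_
  have := Real.exp_pos (-(b * g T R))
  nlinarith

theorem exists_deviationBound_of_large [IsProbabilityMeasure P] (hΘ_bdd : Bornology.IsBounded Θ)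
    (hΘ_convex : Convex ℝ Θ) (hd₀ : 0 < d₀) {g : ℝ → ℝ → ℝ} {δ : ℝ} (hδ : 0 < δ) {γ₂ : Polynomial ℝ}
    {T₀ R₀ T₁ R₁ b B : ℝ} (hT₀ : 0 ≤ T₀) (hR₀ : 0 ≤ R₀) (hT₁ : T₀ ≤ T₁)
    (hb0 : 0 ≤ b) (hθ : θ ∈ Θ) (hd : ∀ T > T₀, NormingWellDefined a T θ)
    (hR1ii : ∀ T > T₀, ∀ R > R₀, CondR1ii a Θ γ₂ θ T R)
    (hR2 : ∀ T > T₀, ∀ R > R₀, CondR2 a Θ g d₀ δ θ T R)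
    (hlarge : ∀ T > T₁, ∀ R > R₁, LSEDeviationBound P a ε Θ g B b θ T R) :
    ∃ B₀ > 0, ∀ T > T₀, ∀ R > R₀, LSEDeviationBound P a ε Θ g B₀ b θ T R := by
  -- `D` bounds the normed set for all `T ≤ T₁`, since `d_T` increases with `T`. The time `T₁ + 1`
  -- is used because the norming is known to be well defined only strictly beyond `T₀`, and `T₁` may
  -- equal `T₀`.
  obtain ⟨D, hD⟩ := hΘ_bdd.isCompact_closure.exists_bound_of_continuousOn
    (f := fun τ => dMul a (T₁ + 1) θ (τ - θ))
    ((continuous_diagMul _).comp (continuous_id.sub continuous_const)).continuousOn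
  obtain ⟨M, hM⟩ := (isCompact_Icc (a := 0) (b := max R₁ D)).exists_bound_of_continuousOn
    γ₂.continuous.continuousOn
  set c : ℝ := 2 * d₀ * (δ ^ 2)⁻¹
  have hc : 0 < c := by positivity
  refine ⟨max B (Real.exp (b * (M / c))), lt_max_of_lt_right (Real.exp_pos _), ?_⟩
  intro T hT R hR θhat hLSE
  by_cases hTR : T₁ < T ∧ R₁ < R
  · exact (hlarge T hTR.1 R hTR.2 θhat hLSE).trans (by gcongr; exact le_max_left _ _)
  by_cases hzero : P {ω | R ≤ ‖dMul a T θ (θhat ω - θ)‖} = 0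
  · rw [Measure.real, hzero, ENNReal.toReal_zero]
    exact mul_nonneg (le_max_of_le_right (Real.exp_pos _).le) (Real.exp_pos _).le
  have hT0 : 0 < T := hT₀.trans_lt hT
  have hR0 : 0 < R := hR₀.trans_lt hR
  -- A non-null deviation event provides an actual point of the normed set at distance at least `R`;
  -- this bounds `R` and makes the shell nonempty, so (R1)(ii) and (R2) can be compared.
  obtain ⟨ω, hωR, hmem⟩ :=
    ((frequently_ae_mem_iff.2 hzero).and_eventually hLSE.mem_closure).exists
  have hωR' : R ≤ ‖dMul a T θ (θhat ω - θ)‖ := hωR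
  obtain ⟨u, hu⟩ := shell_nonempty_of_le_norm hΘ_convex hθ hR0 ⟨θhat ω, hmem, rfl⟩ hωR'
  have hRle : R ≤ max R₁ D := by
    rcases not_and_or.1 hTR with h | h
    · refine le_max_of_le_right (hωR'.trans (le_trans ?_ (hD _ hmem)))
      exact (hd (T₁ + 1) (hT₁.trans_lt (lt_add_one T₁))).norm_dMul_mono hT0.le (by linarith) _
    · exact le_max_of_le_left (not_lt.1 h)
  have hgM : g T R ≤ M / c := by
    rw [le_div_iff₀ hc, mul_comm]
    exact ((hR2 T hT R hR u hu).trans (hR1ii T hT R hR u hu)).trans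
      ((le_abs_self _).trans (hM R ⟨hR0.le, hRle⟩))
  calc P.real {ω | R ≤ ‖dMul a T θ (θhat ω - θ)‖} ≤ 1 := measureReal_le_one
    _ ≤ Real.exp (b * (M / c)) * Real.exp (-(b * g T R)) := by
        rw [← Real.exp_add]
        refine Real.one_le_exp ?_
        have := mul_le_mul_of_nonneg_left hgM hb0
        linarith
    _ ≤ _ := by
        gcongr
        exact le_max_right _ _

end RegressionLD

end RegressionModel

theorem theorem1
    {Ω : Type*} [MeasurableSpace Ω] (P : Measure Ω) [IsProbabilityMeasure P]
    {q : ℕ} (Θ : Set (RegressionLD.Param q))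
    (hΘ_open : IsOpen Θ) (hΘ_bdd : Bornology.IsBounded Θ) (hΘ_convex : Convex ℝ Θ)
    (a : ℝ → RegressionLD.Param q → ℝ) (ha : RegressionLD.IsRegressionFunction Θ a)
    (ε : ℝ → Ω → ℝ) (hN1 : RegressionLD.IsContinuousNoise P ε)
    (hN2i : RegressionLD.IsJointlyStrictlySubGaussian P ε)
    (d₀ : ℝ) (hd₀ : 0 < d₀) (hN2ii : RegressionLD.CovarianceBound P ε d₀)
    (g : ℝ → ℝ → ℝ) (hg : RegressionLD.IsClassG g)
    (δ κ ρ : ℝ) (hδ : δ ∈ Set.Ioo (0 : ℝ) (1 / 2)) (hκ : 0 < κ) (hρ : ρ ∈ Set.Ioc (0 : ℝ) 1)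
    (γ₁ γ₂ : Polynomial ℝ) (T₀ R₀ : ℝ) (hT₀ : 0 ≤ T₀) (hR₀ : 0 ≤ R₀)
    (K : Set (RegressionLD.Param q)) (hK : K ⊆ Θ)
    (hd : ∀ θ ∈ K, ∀ T > T₀, RegressionLD.NormingWellDefined a T θ)
    (hR1i : ∀ θ ∈ K, ∀ T > T₀, ∀ R > R₀, RegressionLD.CondR1i a Θ γ₁ κ ρ θ T R)
    (hR1ii : ∀ θ ∈ K, ∀ T > T₀, ∀ R > R₀, RegressionLD.CondR1ii a Θ γ₂ θ T R)
    (hR2 : ∀ θ ∈ K, ∀ T > T₀, ∀ R > R₀, RegressionLD.CondR2 a Θ g d₀ δ θ T R) :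
    ∃ T₁ ≥ T₀, ∃ R₁ ≥ R₀, ∀ β > 0, ∃ b₀ > 0, ρ / (ρ + q) - β ≤ b₀ ∧
      (∀ θ ∈ K, ∃ B₀ > 0, ∀ T > T₀, ∀ R > R₀,
        RegressionLD.LSEDeviationBound P a ε Θ g B₀ b₀ θ T R) ∧
      (∃ B₀ > 0, ∀ θ ∈ K, ∀ T > T₁, ∀ R > R₁,
        RegressionLD.LSEDeviationBound P a ε Θ g B₀ b₀ θ T R) := by
  -- For `q = 0` the error vanishes and `ρ / (ρ + q) = 1`, so the bound by `1/2` used below fails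
  -- and the case is separate.
  rcases Nat.eq_zero_or_pos q with rfl | hq
  · have htriv : ∀ θ ∈ K, ∀ T > T₀, ∀ R > R₀,
        RegressionLD.LSEDeviationBound P a ε Θ g 1 1 θ T R := by
      intro θ _ T _ R hR θhat _
      have hempty : {ω | R ≤ ‖RegressionLD.dMul a T θ (θhat ω - θ)‖} = ∅ := by
        ext ω
        simp [Subsingleton.elim (RegressionLD.dMul a T θ (θhat ω - θ)) 0, hR₀.trans_lt hR]
      rw [hempty, measureReal_empty]
      positivity
    refine ⟨T₀, le_rfl, R₀, le_rfl, fun β hβ => ⟨1, one_pos, ?_,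
      fun θ hθ => ⟨1, one_pos, htriv θ hθ⟩, 1, one_pos, htriv⟩⟩
    rw [Nat.cast_zero, add_zero, div_self hρ.1.ne']
    linarith
  · have hq1 : (1 : ℝ) ≤ q := by exact_mod_cast hq
    have hρ0 : 0 < ρ := hρ.1
    have hb0 : 0 < ρ / (ρ + q) := by positivity
    have hb : ρ / (ρ + q) ≤ 1 / 2 := by
      rw [div_le_iff₀ (by positivity)]
      linarith [hρ.2]
    obtain ⟨T₁, hT₁, R₁, hR₁, B, hB, hunif⟩ := RegressionLD.exists_uniform_deviationBound hq ha
      hN1 hN2i hd₀ hN2ii hg hδ hκ hρ0 hT₀ hb0.le hb hK hd hR1i hR2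
    exact ⟨T₁, hT₁, R₁, hR₁, fun β hβ => ⟨_, hb0, by linarith, fun θ hθ =>
      RegressionLD.exists_deviationBound_of_large hΘ_bdd hΘ_convex hd₀ hδ.1 hT₀ hR₀ hT₁
        hb0.le (hK hθ) (hd θ hθ) (hR1ii θ hθ) (hR2 θ hθ) (hunif θ hθ), B, hB, hunif⟩⟩
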